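/- Let $R=\mathbb R[[t]]$ with maximal ideal $\mathfrak m=(t)$, write $p(0)$ for the constant term of $p\in R$, and let $A$ (the real Gelfand order) be the $\mathbb R$-algebra of all matrices $a=(a_{ij})\in M_3(R)$ with $a_{13},a_{23}\in\mathfrak m$, $a_{11}(0)=a_{22}(0)$ and $a_{21}(0)=-a_{12}(0)$. Let $\mathsf{Rep}(A)$ be the category of $A$-modules that are finite dimensional over $\mathbb R$; an object $M$ is called Schurian if $\mathrm{End}_A(M)$ is a division algebra. With $e=E_{11}+E_{22}$ and $f=E_{33}$, the dimension vector of $M$ is $\bigl(\tfrac12\dim_{\mathbb R}eM,\ \dim_{\mathbb R}fM\bigr)$. Let $U,V$ be finite dimensional real vector spaces and let $Y=\binom{Y_1}{Y_2}\colon V\to U\oplus U$ and $X=(X_1\ X_2)\colon U\oplus U\to V$ be linear maps, at least one of which is zero. Put $J(u_1,u_2)=(-u_2,u_1)$. We denote by $\bigl[V\underset{X}{\overset{Y}{\rightleftarrows}}U\oplus U\bigr]$ the $A$-module $(U\oplus U)\oplus V$ on which $a\in A$ acts by $$a\cdot(w,v)=\bigl(\alpha w+\beta Jw+c_1Yv+c_2JYv,\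 \ b_1Xw-b_2XJw+\rho v\bigr),$$ where $\alpha=a_{11}(0)$, $\beta=a_{21}(0)$, $b_j=a_{3j}(0)$, $\rho=a_{33}(0)$, and $c_i$ is the coefficient of $t$ in $a_{i3}$. (So $E_{21}-E_{12}$ acts on $eM=U\oplus U$ by $J$, the element $tE_{13}$ acts by $Y\colon fM\to eM$, and $E_{31}$ acts by $X\colon eM\to fM$.) **Theorem.** Up to isomorphism, $\mathsf{Rep}(A)$ contains precisely six Schurian objects; that is, the following six modules are Schurian and pairwise non-isomorphic, and every Schurian object of $\mathsf{Rep}(A)$ is isomorphic to one of them. (a) Two simple modules $S$ ($U=\mathbb R$, $V=0$) and $T$ ($U=0$, $V=\mathbb R$), of dimension vectors $(1,0)$ and $(0,1)$, respectively. (b) Two modules of length two, with $U=V=\mathbb R$: one with $Y=\binom{1}{0}$, $X=0$, and one with $Y=0$, $X=(1\ \ 0)$. Their endomorphism algebras are isomorphic to $\mathbb R$. (c) Two modules of length three, with $U=\mathbb R$, $V=\mathbb R^2$: one with $Y=\begin{pmatrix}1&0\\0&1\end{pmatrix}$, $X=0$, and one with $Y=0$, $X=\begin{pmatrix}1&0\\0&1\end{pmatrix}$.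 Their endomorphism algebras are isomorphic to $\mathbb C$. -/

import Mathlib

open scoped PowerSeries

noncomputable section

namespace RealGelfand

/-- The ring of formal power series `R = ℝ⟦t⟧`; its maximal ideal `𝔪 = (t)` consists of the
series with vanishing constant coefficient. -/
abbrev R : Type := ℝ⟦X⟧

/-- The value `p(0)` of a power series. -/
abbrev ev0 : R →+* ℝ := PowerSeries.constantCoeff

/-- The real Gelfand order: all matrices over `ℝ⟦t⟧` whose entries `(1,3)` and `(2,3)` lie in `𝔪`
and which satisfy `a₁₁(0) = a₂₂(0)`, `a₂₁(0) = -a₁₂(0)`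
(rows and columns are numbered from `0` in the code). -/
def order : Subalgebra ℝ (Matrix (Fin 3) (Fin 3) R) where
  carrier := {a | ev0 (a 0 2) = 0 ∧ ev0 (a 1 2) = 0 ∧
    ev0 (a 0 0) = ev0 (a 1 1) ∧ ev0 (a 1 0) = - ev0 (a 0 1)}
  mul_mem' := by
    rintro a b ⟨h1, h2, h3, h4⟩ ⟨k1, k2, k3, k4⟩
    simp only [Set.mem_ofPred_eq, Matrix.mul_apply, Fin.sum_univ_three, map_add, map_mul,
      h1, h2, h3, h4, k1, k2, k3, k4]
    refine ⟨?_, ?_, ?_, ?_⟩ <;> ring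
  add_mem' := by
    rintro a b ⟨h1, h2, h3, h4⟩ ⟨k1, k2, k3, k4⟩
    simp only [Set.mem_ofPred_eq, Matrix.add_apply, map_add, h1, h2, h3, h4, k1, k2, k3, k4]
    refine ⟨by ring, by ring, trivial, by ring⟩
  algebraMap_mem' := by
    intro r
    simp [Matrix.algebraMap_matrix_apply]

/-- The real Gelfand order as a type. -/
abbrev A : Type := order

/-- The idempotent `e = E₁₁ + E₂₂`. -/
def idemE : A := ⟨!![1, 0, 0; 0, 1, 0; 0, 0, 0], by simp [order]⟩

/-- The idempotent `f = E₃₃`. -/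
def idemF : A := ⟨!![0, 0, 0; 0, 0, 0; 0, 0, 1], by simp [order]⟩

/-! ### Evaluating power series at a nilpotent endomorphism -/

section NilEval

variable {V : Type*} [AddCommGroup V] [Module ℝ V]

theorem aeval_trunc_eq {N : ℕ} {τ : Module.End ℝ V} (h : τ ^ N = 0) (p : R)
    (P : Polynomial ℝ) (hP : ∀ d < N, P.coeff d = PowerSeries.coeff d p) :
    Polynomial.aeval τ (PowerSeries.trunc N p) = Polynomial.aeval τ P := by
  have hd : (Polynomial.X : Polynomial ℝ) ^ N ∣ PowerSeries.trunc N p - P := by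
    rw [Polynomial.X_pow_dvd_iff]
    intro d hd
    rw [Polynomial.coeff_sub, PowerSeries.coeff_trunc, if_pos hd, hP d hd, sub_self]
  obtain ⟨Q, hQ⟩ := hd
  rw [← sub_eq_zero, ← map_sub, hQ, map_mul, map_pow, Polynomial.aeval_X, h, zero_mul]

/-- `p ↦ p(τ) = ∑ₙ pₙ τⁿ` for a nilpotent endomorphism `τ`; the sum is finite. -/
def nilEval (τ : Module.End ℝ V) (hτ : IsNilpotent τ) : R →ₐ[ℝ] Module.End ℝ V where
  toFun p := Polynomial.aeval τ (PowerSeries.trunc (nilpotencyClass τ) p)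
  map_one' := by
    rw [aeval_trunc_eq (pow_nilpotencyClass hτ) 1 1 (by
      intro d _; simp [Polynomial.coeff_one, PowerSeries.coeff_one]), map_one]
  map_mul' p q := by
    rw [aeval_trunc_eq (pow_nilpotencyClass hτ) (p * q)
      (PowerSeries.trunc (nilpotencyClass τ) p * PowerSeries.trunc (nilpotencyClass τ) q), map_mul]
    intro d hd
    rw [PowerSeries.coeff_mul_eq_coeff_trunc_mul_trunc p q hd]
    rw [← Polynomial.coeff_coe, Polynomial.coe_mul]
  map_zero' := by simp
  map_add' p q := by simp
  commutes' r := by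
    rw [aeval_trunc_eq (pow_nilpotencyClass hτ) _ (Polynomial.C r) (by
      intro d _
      rw [Polynomial.coeff_C, PowerSeries.algebraMap_apply, PowerSeries.coeff_C]
      simp), Polynomial.aeval_C]

theorem nilEval_X (τ : Module.End ℝ V) (hτ : IsNilpotent τ) :
    nilEval τ hτ PowerSeries.X = τ := by
  change Polynomial.aeval τ (PowerSeries.trunc (nilpotencyClass τ) PowerSeries.X) = τ
  rw [aeval_trunc_eq (pow_nilpotencyClass hτ) _ Polynomial.X (by
    intro d _; simp [Polynomial.coeff_X, PowerSeries.coeff_X, eq_comm]), Polynomial.aeval_X]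

end NilEval

/-- `(p - p(0)) / t`. -/
def shift : R →ₗ[ℝ] R where
  toFun p := PowerSeries.mk fun n => PowerSeries.coeff (n + 1) p
  map_add' p q := by ext n; simp
  map_smul' c p := by ext n; simp

theorem eq_shift (p : R) : p = PowerSeries.X * shift p + algebraMap ℝ R (ev0 p) :=
  PowerSeries.eq_X_mul_shift_add_const p

theorem shift_unique {p q : R} {c : ℝ} (h : p = PowerSeries.X * q + algebraMap ℝ R c) :
    shift p = q := by
  ext n
  simp [shift, h, PowerSeries.coeff_succ_X_mul]

theorem shift_mul (p q : R) : shift (p * q) =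
    ev0 p • shift q + ev0 q • shift p + PowerSeries.X * (shift p * shift q) := by
  apply shift_unique (c := ev0 p * ev0 q)
  conv_lhs => rw [eq_shift p, eq_shift q]
  simp only [Algebra.smul_def, map_mul]
  ring

theorem shift_mul_of_ev0_eq_zero {p : R} (hp : ev0 p = 0) (q : R) :
    shift (p * q) = shift p * q := by
  rw [shift_mul, hp, zero_smul, zero_add]
  conv_rhs => rw [eq_shift q]
  rw [Algebra.smul_def]
  ring

section Identities

variable {K V : Type*} [CommRing K] [Algebra ℝ K] [AddCommGroup V] [Module ℝ V] [Module K V]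
  [IsScalarTower ℝ K V]

theorem lower_row (t a0 a1 a2 s00 s01 s02 s10 s11 s12 b20 b21 b22 : K) (c d : ℝ) (p q v : V) :
    (a0 * (t * s00 + algebraMap ℝ K c) + a1 * (t * s10 + algebraMap ℝ K d) + a2 * b20) • p
      + (a0 * (t * s01 + algebraMap ℝ K (-d)) + a1 * (t * s11 + algebraMap ℝ K c) + a2 * b21) • -q
      + (a0 * (t * s02 + algebraMap ℝ K 0) + a1 * (t * s12 + algebraMap ℝ K 0) + a2 * b22) • v
    = a0 • (c • p + d • q + t • (s00 • p + s01 • -q + s02 • v))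
      + a1 • -(c • q - d • p - t • (s10 • p + s11 • -q + s12 • v))
      + a2 • (b20 • p + b21 • -q + b22 • v) := by
  simp only [map_neg, map_zero, ← algebraMap_smul K c, ← algebraMap_smul K d]
  module

theorem upper_row (t s0 s1 s2 s00 s01 s02 s10 s11 s12 b20 b21 b22 : K) (α β c d : ℝ)
    (p q v : V) :
    ((α • s00 + c • s0 + t * (s0 * s00)) + (β • s10 + d • s1 + t * (s1 * s10)) + s2 * b20) • p
      + ((α • s01 + (-d) • s0 + t * (s0 * s01)) + (β • s11 + c • s1 + t * (s1 * s11))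
        + s2 * b21) • -q
      + ((α • s02 + (0 : ℝ) • s0 + t * (s0 * s02)) + (β • s12 + (0 : ℝ) • s1 + t * (s1 * s12))
        + s2 * b22) • v
    = α • (s00 • p + s01 • -q + s02 • v) + β • (s10 • p + s11 • -q + s12 • v)
      + (s0 • (c • p + d • q + t • (s00 • p + s01 • -q + s02 • v))
        + s1 • -(c • q - d • p - t • (s10 • p + s11 • -q + s12 • v))
        + s2 • (b20 • p + b21 • -q + b22 • v)) := by
  simp only [Algebra.smul_def, ← algebraMap_smul K c, ← algebraMap_smul K d, map_neg, map_zero,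
    ← algebraMap_smul K α (_ : V), ← algebraMap_smul K β (_ : V)]
  module

end Identities

/-! ### Modules given by diagrams of linear maps -/

/-- Linear algebra data for an `A`-module: finite dimensional real vector spaces `U`, `V` and
linear maps `Y = (Y₁, Y₂)ᵗ : V → U ⊕ U` and `X = (X₁, X₂) : U ⊕ U → V`, which describe the action
of `y₁ = tE₁₃` and of `x₁ = E₃₁`, while `ȷ = E₂₁ - E₁₂` acts on `U ⊕ U` by
`(u₁, u₂) ↦ (-u₂, u₁)`. The first relation says that `x₁ȷy₁ = 0`, the second one that
`x₁y₁ = tE₃₃` is nilpotent. -/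
structure Diagram where
  U : Type
  V : Type
  [groupU : AddCommGroup U]
  [moduleU : Module ℝ U]
  [finU : FiniteDimensional ℝ U]
  [groupV : AddCommGroup V]
  [moduleV : Module ℝ V]
  [finV : FiniteDimensional ℝ V]
  X₁ : U →ₗ[ℝ] V
  X₂ : U →ₗ[ℝ] V
  Y₁ : V →ₗ[ℝ] U
  Y₂ : V →ₗ[ℝ] U
  rel : X₁ ∘ₗ Y₂ = X₂ ∘ₗ Y₁
  nilp : IsNilpotent (X₁ ∘ₗ Y₁ + X₂ ∘ₗ Y₂ : Module.End ℝ V)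

namespace Diagram

attribute [instance] groupU moduleU finU groupV moduleV finV

variable (D : Diagram)

/-- The complex structure `(u₁, u₂) ↦ (-u₂, u₁)` on `U ⊕ U`. -/
def J : (D.U × D.U) →ₗ[ℝ] (D.U × D.U) :=
  (-LinearMap.snd ℝ D.U D.U).prod (LinearMap.fst ℝ D.U D.U)

/-- The row `X = (X₁, X₂) : U ⊕ U → V`. -/
def X : (D.U × D.U) →ₗ[ℝ] D.V := D.X₁.coprod D.X₂

/-- The column `Y = (Y₁, Y₂)ᵗ : V → U ⊕ U`. -/
def Y : D.V →ₗ[ℝ] (D.U × D.U) := D.Y₁.prod D.Y₂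

/-- The action of `x₁ = E₃₁` (by `X`) and of `x₂ = E₃₂ = -x₁ȷ`, where `ȷ = E₂₁ - E₁₂`
acts on `U ⊕ U` by `J`. -/
def x : Fin 2 → ((D.U × D.U) →ₗ[ℝ] D.V) := ![D.X, -(D.X ∘ₗ D.J)]

/-- The action of `y₁ = tE₁₃` (by `Y`) and of `y₂ = tE₂₃ = ȷy₁`. -/
def y : Fin 2 → (D.V →ₗ[ℝ] (D.U × D.U)) := ![D.Y, D.J ∘ₗ D.Y]

/-- The action of `t` on `V`, that is, of `x₁y₁ = x₂y₂ = tE₃₃`. -/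
def τ : Module.End ℝ D.V := D.X₁ ∘ₗ D.Y₁ + D.X₂ ∘ₗ D.Y₂

/-- The action of a power series on `V`. -/
def ev : R →ₐ[ℝ] Module.End ℝ D.V := nilEval D.τ D.nilp

/-- The underlying real vector space `U ⊕ U ⊕ V` of the `A`-module given by a diagram. -/
def Mod : Type := (D.U × D.U) × D.V

instance : AddCommGroup D.Mod := inferInstanceAs (AddCommGroup ((D.U × D.U) × D.V))
instance : Module ℝ D.Mod := inferInstanceAs (Module ℝ ((D.U × D.U) × D.V))
instance : FiniteDimensional ℝ D.Mod :=
  inferInstanceAs (FiniteDimensional ℝ ((D.U × D.U) × D.V))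

/-- The `U ⊕ U`-component of the action of a matrix `a`. The constant part of its upper left
`2 × 2`-block acts by `a₁₁(0) + a₂₁(0) J`; moreover
`tⁿ⁺¹Eᵢⱼ = yᵢ tⁿ xⱼ` and `tⁿ⁺¹Eᵢ₃ = yᵢ tⁿ` for `i, j ≤ 2`. -/
def actW (a : A) (m : (D.U × D.U) × D.V) : D.U × D.U :=
  ev0 (a.1 0 0) • m.1 + ev0 (a.1 1 0) • D.J m.1
    + ∑ i : Fin 2, D.y i (∑ j : Fin 2, D.ev (shift (a.1 i.castSucc j.castSucc)) (D.x j m.1)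
      + D.ev (shift (a.1 i.castSucc 2)) m.2)

/-- The `V`-component of the action of a matrix `a`: here `tⁿE₃ⱼ = tⁿ xⱼ` for `j ≤ 2`. -/
def actV (a : A) (m : (D.U × D.U) × D.V) : D.V :=
  ∑ j : Fin 2, D.ev (a.1 2 j.castSucc) (D.x j m.1) + D.ev (a.1 2 2) m.2

/-- The action of a matrix `a` on `U ⊕ U ⊕ V`. -/
def act (a : A) (m : D.Mod) : D.Mod := (D.actW a m, D.actV a m)

theorem J_J (w : D.U × D.U) : D.J (D.J w) = -w := by
  simp [J, Prod.ext_iff]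

theorem X_Y (v : D.V) : D.X (D.Y v) = D.τ v := by
  simp [X, Y, τ]

theorem X_J_Y (v : D.V) : D.X (D.J (D.Y v)) = 0 := by
  have h := LinearMap.congr_fun D.rel v
  simp only [LinearMap.comp_apply] at h
  simp [X, Y, J, h]

theorem act_one (m : D.Mod) : D.act 1 m = m := by
  have h1 : shift 1 = 0 := shift_unique (c := 1) (by simp)
  refine Prod.ext ?_ ?_
  · simp [act, actW, Fin.sum_univ_two, Matrix.one_apply, h1]
  · simp [act, actV, Fin.sum_univ_two, Matrix.one_apply]

theorem act_add (a : A) (m m' : D.Mod) : D.act a (m + m') = D.act a m + D.act a m' := by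
  have h1 : (m + m').1 = m.1 + m'.1 := rfl
  have h2 : (m + m').2 = m.2 + m'.2 := rfl
  refine Prod.ext ?_ ?_
  · change D.actW a (m + m') = D.actW a m + D.actW a m'
    simp only [actW, Fin.sum_univ_two, h1, h2, map_add]
    module
  · change D.actV a (m + m') = D.actV a m + D.actV a m'
    simp only [actV, Fin.sum_univ_two, h1, h2, map_add]
    module

theorem add_act (a b : A) (m : D.Mod) : D.act (a + b) m = D.act a m + D.act b m := by
  refine Prod.ext ?_ ?_
  · change D.actW (a + b) m = D.actW a m + D.actW b m
    simp only [actW, Fin.sum_univ_two, Subalgebra.coe_add, Matrix.add_apply, map_add,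
      LinearMap.add_apply]
    module
  · change D.actV (a + b) m = D.actV a m + D.actV b m
    simp only [actV, Fin.sum_univ_two, Subalgebra.coe_add, Matrix.add_apply, map_add,
      LinearMap.add_apply]
    module

theorem smul_act (c : ℝ) (a : A) (m : D.Mod) : D.act (c • a) m = c • D.act a m := by
  refine Prod.ext ?_ ?_
  · change D.actW (c • a) m = c • D.actW a m
    simp only [actW, Fin.sum_univ_two, Subalgebra.coe_smul, Matrix.smul_apply, map_smul, map_add,
      LinearMap.smul_apply, PowerSeries.constantCoeff_smul]
    module
  · change D.actV (c • a) m = c • D.actV a m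
    simp only [actV, Fin.sum_univ_two, Subalgebra.coe_smul, Matrix.smul_apply, map_smul,
      LinearMap.smul_apply]
    module

/-- `V` as a module over `ℝ⟦t⟧`. -/
abbrev moduleRV : Module R D.V := Module.compHom D.V D.ev.toRingHom

theorem act_mul (a b : A) (m : D.Mod) : D.act (a * b) m = D.act a (D.act b m) := by
  obtain ⟨w, v⟩ := m
  obtain ⟨ha1, ha2, ha3, ha4⟩ := a.2
  obtain ⟨hb1, hb2, hb3, hb4⟩ := b.2
  have ha4' : ev0 (a.1 0 1) = -ev0 (a.1 1 0) := by rw [ha4, neg_neg]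
  have hb4' : ev0 (b.1 0 1) = -ev0 (b.1 1 0) := by rw [hb4, neg_neg]
  let _ : Module R D.V := D.moduleRV
  have hev : ∀ (p : R) (v : D.V), D.ev p v = p • v := fun _ _ => rfl
  have _ : IsScalarTower ℝ R D.V := ⟨fun c p v => by
    rw [← hev, ← hev, map_smul, LinearMap.smul_apply]⟩
  have hτ : ∀ v, D.τ v = (PowerSeries.X : R) • v := fun v => by
    rw [← hev]; exact congrArg (fun g : Module.End ℝ D.V => g v) (nilEval_X _ D.nilp).symm
  have hmul : ∀ i k, (a * b).1 i k =
      a.1 i 0 * b.1 0 k + a.1 i 1 * b.1 1 k + a.1 i 2 * b.1 2 k := fun i k => by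
    rw [Subalgebra.coe_mul, Matrix.mul_apply, Fin.sum_univ_three]
  have hc1 : Fin.castSucc (1 : Fin 2) = (1 : Fin 3) := rfl
  have hc0 : Fin.castSucc (0 : Fin 2) = (0 : Fin 3) := rfl
  have hx0 : ∀ (α β : ℝ) (p q : D.V), D.X (α • w + β • D.J w + (D.Y p + D.J (D.Y q))) =
      α • D.X w + β • D.X (D.J w) + (PowerSeries.X : R) • p := fun α β p q => by
    simp only [map_add, map_smul, X_Y, X_J_Y, hτ, add_zero]
  have hx1 : ∀ (α β : ℝ) (p q : D.V), D.X (D.J (α • w + β • D.J w + (D.Y p + D.J (D.Y q)))) =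
      α • D.X (D.J w) - β • D.X w - (PowerSeries.X : R) • q := fun α β p q => by
    simp only [map_add, map_smul, X_Y, X_J_Y, J_J, hτ, map_neg, zero_add, smul_neg,
      sub_eq_add_neg]
  refine Prod.ext ?_ ?_
  · change D.actW _ (w, v) = D.actW _ (D.actW _ (w, v), D.actV _ (w, v))
    simp only [actV, actW, x, y, Fin.sum_univ_two,
      Matrix.cons_val_zero, Matrix.cons_val_one, hc0, hc1, hev,
      LinearMap.neg_apply, LinearMap.comp_apply, hx0, hx1]
    have key : ∀ (α β α' β' : ℝ) (P0 P1 Q0 Q1 : D.V),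
        α • (α' • w + β' • D.J w + (D.Y P0 + D.J (D.Y P1)))
          + β • D.J (α' • w + β' • D.J w + (D.Y P0 + D.J (D.Y P1))) + (D.Y Q0 + D.J (D.Y Q1))
        = (α * α' - β * β') • w + (β * α' + α * β') • D.J w
          + (D.Y (α • P0 + (-β) • P1 + Q0) + D.J (D.Y (β • P0 + α • P1 + Q1))) := by
      intro α β α' β' P0 P1 Q0 Q1
      simp only [map_add, map_smul, J_J]
      module
    rw [key, ← upper_row, ← upper_row]
    simp only [hmul, map_add, map_mul, shift_mul_of_ev0_eq_zero ha1, shift_mul_of_ev0_eq_zero ha2,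
      shift_mul (a.1 0 0), shift_mul (a.1 0 1), shift_mul (a.1 1 0), shift_mul (a.1 1 1),
      ha1, ha2, ← ha3, ha4', hb1, hb2, ← hb3, hb4']
    congr 3 <;> ring
  · change D.actV _ (w, v) = D.actV _ (D.actW _ (w, v), D.actV _ (w, v))
    simp only [actV, actW, x, y, Fin.sum_univ_two,
      Matrix.cons_val_zero, Matrix.cons_val_one, hc0, hc1, hev,
      LinearMap.neg_apply, LinearMap.comp_apply, hx0, hx1]
    have h00 := (eq_shift (b.1 0 0)).symm
    have h01 := (eq_shift (b.1 0 1)).symm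
    have h02 := (eq_shift (b.1 0 2)).symm
    have h10 := (eq_shift (b.1 1 0)).symm
    have h11 := (eq_shift (b.1 1 1)).symm
    have h12 := (eq_shift (b.1 1 2)).symm
    rw [hb4'] at h01
    rw [hb1] at h02
    rw [← hb3] at h11
    rw [hb2] at h12
    rw [← lower_row, hmul, hmul, hmul, h00, h01, h02, h10, h11, h12]

/-- The `A`-module given by a diagram. -/
instance : Module A D.Mod where
  smul := D.act
  one_smul := D.act_one
  mul_smul := D.act_mul
  smul_add := D.act_add
  add_smul := D.add_act
  smul_zero a := by
    change D.act a 0 = 0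
    simpa using D.act_add a 0 0
  zero_smul m := by
    change D.act 0 m = 0
    simpa using D.add_act 0 0 m

instance : IsScalarTower ℝ A D.Mod := ⟨fun c a m => D.smul_act c a m⟩

end Diagram

/-! ### The six diagrams -/

/-- `U = ℝ`, `V = 0`. -/
def diagS : Diagram where
  U := ℝ
  V := PUnit
  X₁ := 0
  X₂ := 0
  Y₁ := 0
  Y₂ := 0
  rel := by simp
  nilp := by simp

/-- `U = 0`, `V = ℝ`. -/
def diagT : Diagram where
  U := PUnit
  V := ℝ
  X₁ := 0
  X₂ := 0
  Y₁ := 0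
  Y₂ := 0
  rel := by simp
  nilp := by simp

/-- `U = V = ℝ`, `Y = (1, 0)ᵗ`, `X = 0`. -/
def diagY₁ : Diagram where
  U := ℝ
  V := ℝ
  X₁ := 0
  X₂ := 0
  Y₁ := LinearMap.id
  Y₂ := 0
  rel := by simp
  nilp := by simp

/-- `U = V = ℝ`, `Y = 0`, `X = (1, 0)`. -/
def diagX₁ : Diagram where
  U := ℝ
  V := ℝ
  X₁ := LinearMap.id
  X₂ := 0
  Y₁ := 0
  Y₂ := 0
  rel := by simp
  nilp := by simp

/-- `U = ℝ`, `V = ℝ²`, `Y` is the identity matrix, `X = 0`. -/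
def diagY₂ : Diagram where
  U := ℝ
  V := ℝ × ℝ
  X₁ := 0
  X₂ := 0
  Y₁ := LinearMap.fst ℝ ℝ ℝ
  Y₂ := LinearMap.snd ℝ ℝ ℝ
  rel := by simp
  nilp := by simp

/-- `U = ℝ`, `V = ℝ²`, `Y = 0`, `X` is the identity matrix. -/
def diagX₂ : Diagram where
  U := ℝ
  V := ℝ × ℝ
  X₁ := LinearMap.inl ℝ ℝ ℝ
  X₂ := LinearMap.inr ℝ ℝ ℝ
  Y₁ := 0
  Y₂ := 0
  rel := by simp
  nilp := by simp

/-- The list of the six diagrams. -/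
def sixDiagrams : Fin 6 → Diagram := ![diagS, diagT, diagY₁, diagX₁, diagY₂, diagX₂]

/-! ### Notions for `A`-modules -/

/-- An `A`-module is Schurian if its endomorphism algebra is a division algebra: it is non-zero
and every non-zero endomorphism is invertible. -/
def IsSchurian (M : Type*) [AddCommGroup M] [Module A M] : Prop :=
  Nontrivial (Module.End A M) ∧ ∀ g : Module.End A M, g ≠ 0 → IsUnit g

/-- `M` has dimension vector `(u, v)`: the real vector space `eM` (which is of the form `U ⊕ U`)
has dimension `2u`, and `V = fM` has dimension `v`. -/
def HasDimVector (M : Type*) [AddCommGroup M] [Module ℝ M] [Module A M] [IsScalarTower ℝ A M]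
    (u v : ℕ) : Prop :=
  Module.finrank ℝ (LinearMap.range (Algebra.lsmul ℝ ℝ M idemE)) = 2 * u ∧
    Module.finrank ℝ (LinearMap.range (Algebra.lsmul ℝ ℝ M idemF)) = v

end RealGelfand

end

/-! The element `t` is central, so it acts on a Schurian module `M` by an endomorphism, which is
zero or bijective. If it were bijective then `tM = M`, and Nakayama's lemma over the local ring
`ℝ⟦t⟧` would give `M = 0`. Hence `t` kills `M` (`IsSchurian.genT_smul`). For modules killed by `t`,
the structure is elementary. The element `ȷ` makes `eM` a complex vector space, and there are real
linear maps `x : eM → fM` and `y : fM → eM` with `xy = 0` and `xȷy = 0`. Real linear maps compatible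
with `e`, `ȷ`, `x₁`, `y₁` are exactly the homomorphisms (`homOfGenerators`). The tool for the
classification is a non-zero endomorphism `g` that has complex rank one on `eM`, of the form `m ↦
Λ(m)w` for a complex functional `Λ` with real part `l` (`exists_rankOne_end`). In a Schurian module
`g` is bijective, so `M` is as small as the image of `g`. If an injective homomorphism from one of
the six modules contains this image in its range, it is an isomorphism
(`IsSchurian.equiv_of_range`). If neither `x` nor `y` were zero, a `g` built from both would kill a
non-zero vector `y₁m`; so one of them vanishes. If both vanish, `M` is `S` or `T`. If only `y`
survives, the question is whether its real image contains a complex line (length three) or is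
totally real (length two). If only `x` survives, the question is whether its kernel on `eM` is zero
(length three) or a non-zero totally real subspace (length two). Conversely, `S` and `T` are simple,
and endomorphisms of the other four modules are determined by the image of one vector, which gives
`ℝ` or `ℂ`. Real dimension together with the vanishing of `y₁` separates the six modules. -/

open scoped PowerSeries

noncomputable section

namespace RealGelfand

/-! ### Generators of the order -/

/-- The element `ȷ = E₂₁ - E₁₂`. -/
def genJ : A := ⟨!![0, -1, 0; 1, 0, 0; 0, 0, 0], by simp [order]⟩

/-- The element `x₁ = E₃₁`. -/
def genX : A := ⟨!![0, 0, 0; 0, 0, 0; 1, 0, 0], by simp [order]⟩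

/-- The element `y₁ = tE₁₃`. -/
def genY : A := ⟨!![0, 0, PowerSeries.X; 0, 0, 0; 0, 0, 0], by simp [order]⟩

/-- The matrices with the given last row and zeros elsewhere. -/
def lastRow (p q r : R) : A := ⟨!![0, 0, 0; 0, 0, 0; p, q, r], by simp [order]⟩

/-- The central embedding of `ℝ⟦t⟧` by scalar matrices. -/
def scalarHom : R →+* A :=
  (algebraMap R (Matrix (Fin 3) (Fin 3) R)).codRestrict order (fun p => by
    change _ ∧ _
    simp [Matrix.algebraMap_matrix_apply])

theorem scalarHom_comm (p : R) (a : A) : scalarHom p * a = a * scalarHom p :=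
  Subtype.ext (Algebra.commutes p a.1)

theorem scalarHom_algebraMap (c : ℝ) : scalarHom (algebraMap ℝ R c) = algebraMap ℝ A c :=
  Subtype.ext (IsScalarTower.algebraMap_apply ℝ R (Matrix (Fin 3) (Fin 3) R) c).symm

/-- The central element `t`. -/
def genT : A := scalarHom PowerSeries.X

theorem ext_of_entries {a b : A} (h : ∀ i j, a.1 i j = b.1 i j) : a = b :=
  Subtype.ext (Matrix.ext h)

theorem genT_coe : genT.1 = !![PowerSeries.X, 0, 0; 0, PowerSeries.X, 0; 0, 0, PowerSeries.X] := by
  ext1 i j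
  change algebraMap R (Matrix (Fin 3) (Fin 3) R) _ i j = _
  fin_cases i <;> fin_cases j <;> simp [Matrix.algebraMap_matrix_apply]

theorem one_coe : (1 : A).1 = !![1, 0, 0; 0, 1, 0; 0, 0, 1] := by
  ext1 i j
  fin_cases i <;> fin_cases j <;> simp

theorem e_e : idemE * idemE = idemE := by
  apply ext_of_entries; intro i j; fin_cases i <;> fin_cases j <;> simp [idemE]
theorem e_j : idemE * genJ = genJ := by
  apply ext_of_entries; intro i j; fin_cases i <;> fin_cases j <;> simp [idemE, genJ]
theorem j_e : genJ * idemE = genJ := by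
  apply ext_of_entries; intro i j; fin_cases i <;> fin_cases j <;> simp [idemE, genJ]
theorem j_j : genJ * genJ = -idemE := by
  apply ext_of_entries; intro i j; fin_cases i <;> fin_cases j <;> simp [idemE, genJ]
theorem e_x : idemE * genX = 0 := by
  apply ext_of_entries; intro i j; fin_cases i <;> fin_cases j <;> simp [idemE, genX]
theorem x_e : genX * idemE = genX := by
  apply ext_of_entries; intro i j; fin_cases i <;> fin_cases j <;> simp [idemE, genX]
theorem e_y : idemE * genY = genY := by
  apply ext_of_entries; intro i j; fin_cases i <;> fin_cases j <;> simp [idemE, genY]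
theorem y_e : genY * idemE = 0 := by
  apply ext_of_entries; intro i j; fin_cases i <;> fin_cases j <;> simp [idemE, genY]
theorem j_x : genJ * genX = 0 := by
  apply ext_of_entries; intro i j; fin_cases i <;> fin_cases j <;> simp [genX, genJ]
theorem y_j : genY * genJ = 0 := by
  apply ext_of_entries; intro i j; fin_cases i <;> fin_cases j <;> simp [genY, genJ]
theorem x_y : genX * genY = genT * idemF := by
  apply ext_of_entries; intro i j
  fin_cases i <;> fin_cases j <;> simp [genX, genY, idemF, genT_coe]
theorem x_j_y : genX * (genJ * genY) = 0 := by
  apply ext_of_entries; intro i j; fin_cases i <;> fin_cases j <;> simp [genX, genJ, genY]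

/-- Split each series into its constant term and a multiple of `t`. The matrix units of the last row
are `E₃₁ = x₁`, `E₃₂ = -x₁ȷ` and `E₃₃ = 1 - e`, and the remainder is invisible on modules killed by
`t`. -/
theorem lastRow_eq (p q r : R) : lastRow p q r =
    ev0 p • genX - ev0 q • (genX * genJ) + ev0 r • (1 - idemE)
      + genT * lastRow (shift p) (shift q) (shift r) := by
  apply Subtype.ext
  simp only [Subalgebra.coe_add, Subalgebra.coe_sub, Subalgebra.coe_smul, Subalgebra.coe_mul,
    genT_coe, one_coe]
  ext1 i j
  fin_cases i <;> fin_cases j <;> simp [lastRow, genX, genJ, idemE]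
  · conv_lhs => rw [eq_shift p, Algebra.algebraMap_eq_smul_one, add_comm]
  · conv_lhs => rw [eq_shift q, Algebra.algebraMap_eq_smul_one, add_comm]
  · conv_lhs => rw [eq_shift r, Algebra.algebraMap_eq_smul_one, add_comm]

/-- The conditions on constant terms leave only `e` and `ȷ` in the upper block. Everything else in
the first two rows is divisible by `t`, hence is `y₁ = tE₁₃` or `ȷy₁ = tE₂₃` times a last row. -/
theorem eq_generators (a : A) : a =
    ev0 (a.1 0 0) • idemE + ev0 (a.1 1 0) • genJ + lastRow (a.1 2 0) (a.1 2 1) (a.1 2 2)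
      + genY * lastRow (shift (a.1 0 0)) (shift (a.1 0 1)) (shift (a.1 0 2))
      + genJ * genY * lastRow (shift (a.1 1 0)) (shift (a.1 1 1)) (shift (a.1 1 2)) := by
  obtain ⟨h1, h2, h3, h4⟩ := a.2
  have h4' : ev0 (a.1 0 1) = -ev0 (a.1 1 0) := by rw [h4, neg_neg]
  have key : ∀ (p : R) (c : ℝ), ev0 p = c → p = c • (1 : R) + PowerSeries.X * shift p := by
    rintro p _ rfl
    rw [← Algebra.algebraMap_eq_smul_one, add_comm]
    exact eq_shift p
  apply Subtype.ext
  simp only [Subalgebra.coe_add, Subalgebra.coe_smul, Subalgebra.coe_mul]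
  ext1 i j
  fin_cases i <;> fin_cases j <;> simp [lastRow, genY, genJ, idemE]
  · exact key _ _ rfl
  · simpa using key _ _ h4'
  · simpa using key _ _ h1
  · exact key _ _ rfl
  · exact key _ _ h3.symm
  · simpa using key _ _ h2

/-! ### Homomorphisms tested on generators -/

section Commute

variable {M N : Type*} [AddCommGroup M] [Module ℝ M] [Module A M] [IsScalarTower ℝ A M]
  [AddCommGroup N] [Module ℝ N] [Module A N] [IsScalarTower ℝ A N]

/-- The elements of the order with which a linear map between modules commutes. -/
def commuting (g : M →ₗ[ℝ] N) : Subalgebra ℝ A where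
  carrier := {a | ∀ m, g (a • m) = a • g m}
  mul_mem' := by
    intro a b ha hb m
    rw [mul_smul, ha, hb, mul_smul]
  add_mem' := by
    intro a b ha hb m
    rw [add_smul, map_add, ha, hb, add_smul]
  algebraMap_mem' := by
    intro r m
    rw [algebraMap_smul, algebraMap_smul, map_smul]

/-- A linear map between modules killed by `t` which commutes with the generators
`e`, `ȷ`, `x₁`, `y₁` is a homomorphism. -/
def homOfGenerators (hM : ∀ m : M, genT • m = 0) (hN : ∀ n : N, genT • n = 0) (g : M →ₗ[ℝ] N)
    (he : ∀ m, g (idemE • m) = idemE • g m) (hj : ∀ m, g (genJ • m) = genJ • g m)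
    (hx : ∀ m, g (genX • m) = genX • g m) (hy : ∀ m, g (genY • m) = genY • g m) :
    M →ₗ[A] N where
  toFun := g
  map_add' := map_add g
  map_smul' a := by
    change a ∈ commuting g
    have he' : idemE ∈ commuting g := he
    have hj' : genJ ∈ commuting g := hj
    have hx' : genX ∈ commuting g := hx
    have hy' : genY ∈ commuting g := hy
    have hr : ∀ p q r, lastRow p q r ∈ commuting g := by
      intro p q r
      rw [lastRow_eq]
      have ht : genT * lastRow (shift p) (shift q) (shift r) ∈ commuting g := by
        intro m
        rw [mul_smul, mul_smul, hM, hN, map_zero]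
      exact add_mem (add_mem (sub_mem (Subalgebra.smul_mem _ hx' _)
        (Subalgebra.smul_mem _ (mul_mem hx' hj') _))
        (Subalgebra.smul_mem _ (sub_mem (one_mem _) he') _)) ht
    rw [eq_generators a]
    exact add_mem (add_mem (add_mem (add_mem (Subalgebra.smul_mem _ he' _)
      (Subalgebra.smul_mem _ hj' _)) (hr _ _ _)) (mul_mem hy' (hr _ _ _)))
      (mul_mem (mul_mem hj' hy') (hr _ _ _))

end Commute

/-! ### The generators acting on modules killed by `t` -/

section Relations

variable {M : Type*} [AddCommGroup M] [Module A M]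

theorem e_e_smul (m : M) : idemE • idemE • m = idemE • m := by rw [smul_smul, e_e]
theorem e_j_smul (m : M) : idemE • genJ • m = genJ • m := by rw [smul_smul, e_j]
theorem j_e_smul (m : M) : genJ • idemE • m = genJ • m := by rw [smul_smul, j_e]
theorem j_j_smul (m : M) : genJ • genJ • m = -(idemE • m) := by rw [smul_smul, j_j, neg_smul]
theorem e_x_smul (m : M) : idemE • genX • m = 0 := by rw [smul_smul, e_x, zero_smul]
theorem x_e_smul (m : M) : genX • idemE • m = genX • m := by rw [smul_smul, x_e]
theorem e_y_smul (m : M) : idemE • genY • m = genY • m := by rw [smul_smul, e_y]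
theorem y_e_smul (m : M) : genY • idemE • m = 0 := by rw [smul_smul, y_e, zero_smul]
theorem j_x_smul (m : M) : genJ • genX • m = 0 := by rw [smul_smul, j_x, zero_smul]
theorem y_j_smul (m : M) : genY • genJ • m = 0 := by rw [smul_smul, y_j, zero_smul]
theorem x_j_y_smul (m : M) : genX • genJ • genY • m = 0 := by
  rw [smul_smul, smul_smul, mul_assoc, x_j_y, zero_smul]
theorem x_y_smul (hM : ∀ m : M, genT • m = 0) (m : M) : genX • genY • m = 0 := by
  rw [smul_smul, x_y, mul_smul, hM]

theorem j_smul_of_e {v : M} (hv : idemE • v = 0) : genJ • v = 0 := by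
  rw [← j_e_smul, hv, smul_zero]

theorem x_smul_of_e {v : M} (hv : idemE • v = 0) : genX • v = 0 := by
  rw [← x_e_smul, hv, smul_zero]

theorem y_smul_of_e {w : M} (hw : idemE • w = w) : genY • w = 0 := by
  rw [← hw, y_e_smul]

variable [Module ℝ M] [IsScalarTower ℝ A M]

theorem order_smul_real_smul (a : A) (c : ℝ) (m : M) : a • c • m = c • a • m :=
  (smul_comm c a m).symm

/-- A non-zero vector of `eM` is linearly independent from its image under `ȷ`. -/
theorem eq_zero_of_smul_add_smul_j {w : M} (hw : idemE • w = w) (hw0 : w ≠ 0) {a b : ℝ}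
    (h : a • w + b • genJ • w = 0) : a = 0 ∧ b = 0 := by
  -- Multiply by the complex conjugate `a - bȷ`.
  have h2 : (a ^ 2 + b ^ 2) • w = 0 := by
    have h1 : genJ • (a • w + b • genJ • w) = 0 := by rw [h, smul_zero]
    rw [smul_add, order_smul_real_smul, order_smul_real_smul, j_j_smul, hw] at h1
    generalize genJ • w = z at h h1
    calc (a ^ 2 + b ^ 2) • w = a • (a • w + b • z) - b • (a • z + b • -w) := by module
      _ = 0 := by rw [h, h1]; simp
  have h3 := (smul_eq_zero.mp h2).resolve_right hw0
  constructor <;> nlinarith [sq_nonneg a, sq_nonneg b]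

end Relations

/-! ### The generators acting on the module of a diagram -/

theorem shift_one : shift 1 = 0 := shift_unique (c := 1) (by simp)

theorem shift_X : shift PowerSeries.X = 1 := shift_unique (c := 0) (by simp)

namespace Diagram

variable (D : Diagram)

/-- The component in `U ⊕ U` of an element of the module of a diagram. -/
def projW : D.Mod →ₗ[ℝ] D.U × D.U := LinearMap.fst ℝ (D.U × D.U) D.V

/-- The component in `V` of an element of the module of a diagram. -/
def projV : D.Mod →ₗ[ℝ] D.V := LinearMap.snd ℝ (D.U × D.U) D.V

/-- The element of the module of a diagram with the given components. -/
def pair (w : D.U × D.U) (v : D.V) : D.Mod := (w, v)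

@[simp]
theorem projW_pair (w : D.U × D.U) (v : D.V) : D.projW (D.pair w v) = w := rfl

@[simp]
theorem projV_pair (w : D.U × D.U) (v : D.V) : D.projV (D.pair w v) = v := rfl

theorem projW_eq (m : D.Mod) : D.projW m = m.1 := rfl

theorem projV_eq (m : D.Mod) : D.projV m = m.2 := rfl

variable {D} in
theorem mod_ext {m n : D.Mod} (h1 : D.projW m = D.projW n) (h2 : D.projV m = D.projV n) : m = n :=
  Prod.ext h1 h2

theorem idemE_smul (m : D.Mod) : idemE • m = D.pair (D.projW m) 0 := by
  change D.act idemE m = _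
  refine Prod.ext ?_ ?_ <;>
    simp [pair, projW_eq, act, actW, actV, idemE, Fin.sum_univ_two, shift_one]

theorem idemF_smul (m : D.Mod) : idemF • m = D.pair 0 (D.projV m) := by
  change D.act idemF m = _
  refine Prod.ext ?_ ?_ <;>
    simp [pair, projV_eq, act, actW, actV, idemF, Fin.sum_univ_two]

theorem genJ_smul (m : D.Mod) : genJ • m = D.pair (D.J (D.projW m)) 0 := by
  change D.act genJ m = _
  refine Prod.ext ?_ ?_ <;>
    simp [pair, projW_eq, act, actW, actV, genJ, Fin.sum_univ_two, shift_one]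

theorem genX_smul (m : D.Mod) : genX • m = D.pair 0 (D.X (D.projW m)) := by
  change D.act genX m = _
  refine Prod.ext ?_ ?_ <;>
    simp [pair, projW_eq, act, actW, actV, genX, x, Fin.sum_univ_two]

theorem genY_smul (m : D.Mod) : genY • m = D.pair (D.Y (D.projV m)) 0 := by
  change D.act genY m = _
  refine Prod.ext ?_ ?_ <;>
    simp [pair, projV_eq, act, actW, actV, genY, y, Fin.sum_univ_two, shift_X]

/-- On `V` the element `t` acts by `XY`, and on `U ⊕ U` by `y₁x₁ + y₂x₂`; every term contains both
`X` and `Y`. -/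
theorem genT_smul (h : D.X = 0 ∨ D.Y = 0) (m : D.Mod) : genT • m = 0 := by
  have hτ : D.τ = 0 := by
    ext v
    rw [← X_Y]
    rcases h with h | h <;> simp [h]
  have hev : D.ev PowerSeries.X = 0 := (nilEval_X _ D.nilp).trans hτ
  change D.act genT m = _
  refine Prod.ext ?_ ?_
  · change D.actW genT m = 0
    rcases h with h | h <;> simp [actW, genT_coe, x, y, Fin.sum_univ_two, shift_X, h]
  · change D.actV genT m = 0
    simp [actV, genT_coe, Fin.sum_univ_two, hev]

variable {D} {M : Type*} [AddCommGroup M] [Module ℝ M] [Module A M] [IsScalarTower ℝ A M]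

/-- The homomorphism from the module of a diagram to a module killed by `t` that is given by
linear maps on `U ⊕ U` and on `V`. -/
def lift (h : D.X = 0 ∨ D.Y = 0) (hM : ∀ m : M, genT • m = 0)
    (φ : (D.U × D.U) →ₗ[ℝ] M) (ψ : D.V →ₗ[ℝ] M)
    (heφ : ∀ w, idemE • φ w = φ w) (heψ : ∀ v, idemE • ψ v = 0)
    (hj : ∀ w, genJ • φ w = φ (D.J w))
    (hx : ∀ w, genX • φ w = ψ (D.X w)) (hy : ∀ v, genY • ψ v = φ (D.Y v)) : D.Mod →ₗ[A] M :=
  homOfGenerators (D.genT_smul h) hM (φ ∘ₗ D.projW + ψ ∘ₗ D.projV)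
    (fun m => by simp [idemE_smul, heφ, heψ])
    (fun m => by simp [genJ_smul, hj, j_smul_of_e (heψ _)])
    (fun m => by simp [genX_smul, hx, x_smul_of_e (heψ _)])
    (fun m => by simp [genY_smul, hy, y_smul_of_e (heφ _)])

end Diagram

/-! ### Schurian modules are killed by `t` -/

theorem IsSchurian.nontrivial {M : Type*} [AddCommGroup M] [Module A M] (h : IsSchurian M) :
    Nontrivial M := by
  obtain ⟨g, hg⟩ := @exists_ne _ h.1 (0 : Module.End A M)
  by_contra hM
  rw [not_nontrivial_iff_subsingleton] at hM
  exact hg (LinearMap.ext fun m => Subsingleton.elim _ _)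

theorem IsSchurian.bijective {M : Type*} [AddCommGroup M] [Module A M] (h : IsSchurian M)
    {g : M →ₗ[A] M} (hg : g ≠ 0) : Function.Bijective g :=
  (Module.End.isUnit_iff g).mp (h.2 g hg)

/-- Centrality makes the action of `t` an endomorphism, and Nakayama's lemma excludes that it is
bijective. -/
theorem IsSchurian.genT_smul {M : Type*} [AddCommGroup M] [Module ℝ M] [Module A M]
    [IsScalarTower ℝ A M] [FiniteDimensional ℝ M] (h : IsSchurian M) (m : M) :
    genT • m = 0 := by
  let T : M →ₗ[A] M :=
    { toFun := fun m => genT • m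
      map_add' := smul_add _
      map_smul' := fun a m => by
        rw [RingHom.id_apply, smul_smul, smul_smul, genT, scalarHom_comm] }
  by_cases hT : T = 0
  · exact LinearMap.congr_fun hT m
  exfalso
  have hs := (h.bijective hT).surjective
  let _ : Module R M := Module.compHom M scalarHom
  have hR : ∀ (p : R) (m : M), p • m = scalarHom p • m := fun _ _ => rfl
  have _ : IsScalarTower ℝ R M := ⟨fun c p m => by
    rw [hR, hR, Algebra.smul_def, map_mul, mul_smul, scalarHom_algebraMap, algebraMap_smul]⟩
  have _ : Module.Finite R M := Module.Finite.of_restrictScalars_finite ℝ R M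
  -- Surjectivity of `t` says `M = 𝔪M`, where `M` is finitely generated over the local ring `R`.
  have htop : (⊤ : Submodule R M) = ⊥ := by
    refine Submodule.eq_bot_of_le_smul_of_le_jacobson_bot (IsLocalRing.maximalIdeal R) ⊤
      Module.Finite.fg_top (fun m _ => ?_) (IsLocalRing.maximalIdeal_le_jacobson ⊥)
    obtain ⟨n, rfl⟩ := hs m
    refine Submodule.smul_mem_smul (r := (PowerSeries.X : R)) (n := n) ?_ trivial
    rw [IsLocalRing.mem_maximalIdeal, mem_nonunits_iff]
    exact PowerSeries.X_prime.not_isUnit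
  obtain ⟨n, hn⟩ := @exists_ne _ h.nontrivial (0 : M)
  exact hn ((Submodule.mem_bot R).mp (htop ▸ Submodule.mem_top))

/-! ### Classification of the Schurian modules -/

theorem exists_functional {M : Type*} [AddCommGroup M] [Module ℝ M] {P : Submodule ℝ M} {v : M}
    (hv : v ∉ P) : ∃ l : M →ₗ[ℝ] ℝ, l v = 1 ∧ ∀ u ∈ P, l u = 0 := by
  obtain ⟨l, hl, hP⟩ := P.exists_le_ker_of_notMem hv
  refine ⟨(l v)⁻¹ • l, by simp [hl], fun u hu => ?_⟩
  simp [LinearMap.mem_ker.mp (hP hu)]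

theorem exists_functional_of_ne_zero {M : Type*} [AddCommGroup M] [Module ℝ M] {v : M}
    (hv : v ≠ 0) : ∃ l : M →ₗ[ℝ] ℝ, l v = 1 := by
  obtain ⟨l, hl, -⟩ := exists_functional (P := ⊥) (v := v) (by simpa using hv)
  exact ⟨l, hl⟩

/-- A functional vanishing on the kernel of a linear map factors through this map. -/
theorem exists_factor {M N : Type*} [AddCommGroup M] [Module ℝ M] [AddCommGroup N] [Module ℝ N]
    (k : M →ₗ[ℝ] ℝ) (s : M →ₗ[ℝ] N) (h : ∀ m, s m = 0 → k m = 0) :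
    ∃ n : N →ₗ[ℝ] ℝ, ∀ m, k m = n (s m) := by
  have hk : k ∈ LinearMap.range s.dualMap := by
    rw [LinearMap.range_dualMap_eq_dualAnnihilator_ker, Submodule.mem_dualAnnihilator]
    exact fun m hm => h m hm
  obtain ⟨n, rfl⟩ := hk
  exact ⟨n, fun _ => rfl⟩

/-! ### Endomorphisms of complex rank one -/

section

variable {M : Type*} [AddCommGroup M] [Module A M]

theorem e_smul_lower (m : M) : idemE • (m - idemE • m) = 0 := by
  rw [smul_sub, e_e_smul, sub_self]

theorem y_smul_lower (m : M) : genY • (m - idemE • m) = genY • m := by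
  rw [smul_sub, y_e_smul, sub_zero]

/-- A non-zero `g` is surjective, so an `L` whose range contains that of `g` is surjective too. This
turns each explicit endomorphism into an isomorphism with one of the six modules. -/
theorem IsSchurian.equiv_of_range {N : Type*} [AddCommGroup N] [Module A N] (h : IsSchurian M)
    {g : M →ₗ[A] M} (hg : g ≠ 0) {L : N →ₗ[A] M} (hL : ∀ n, L n = 0 → n = 0)
    (hr : ∀ m, ∃ n, L n = g m) : Nonempty (M ≃ₗ[A] N) := by
  refine ⟨(LinearEquiv.ofBijective L ⟨(injective_iff_map_eq_zero L).mpr hL, fun m => ?_⟩).symm⟩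
  obtain ⟨m', rfl⟩ := (h.bijective hg).surjective m
  exact hr m'

variable [Module ℝ M]

/-- The map `(a, b) ↦ aw + bȷw`. -/
def plane (w : M) : ℝ × ℝ →ₗ[ℝ] M :=
  (LinearMap.toSpanSingleton ℝ M w).coprod (LinearMap.toSpanSingleton ℝ M (genJ • w))

theorem plane_apply (w : M) (p : ℝ × ℝ) : plane w p = p.1 • w + p.2 • genJ • w := rfl

variable [IsScalarTower ℝ A M]

/-- The `ℂ`-linear map of rank one `m ↦ Λ(m)w` on `eM`, where `Λ` is the complex functional with
real part `l` and `ȷ` acts as the imaginary unit. -/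
def rankOne (l : M →ₗ[ℝ] ℝ) (w : M) : M →ₗ[ℝ] M :=
  (l ∘ₗ Algebra.lsmul ℝ ℝ M idemE).smulRight w
    - (l ∘ₗ Algebra.lsmul ℝ ℝ M genJ).smulRight (genJ • w)

theorem rankOne_apply (l : M →ₗ[ℝ] ℝ) (w m : M) :
    rankOne l w m = l (idemE • m) • w - l (genJ • m) • genJ • w := rfl

/-- The functional `m ↦ n(fm)`. -/
def lowerPart (n : M →ₗ[ℝ] ℝ) : M →ₗ[ℝ] ℝ := n - n ∘ₗ Algebra.lsmul ℝ ℝ M idemE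

theorem lowerPart_apply (n : M →ₗ[ℝ] ℝ) (m : M) : lowerPart n m = n m - n (idemE • m) := rfl

theorem lowerPart_e_smul (n : M →ₗ[ℝ] ℝ) (m : M) : lowerPart n (idemE • m) = 0 := by
  rw [lowerPart_apply, e_e_smul, sub_self]

theorem lowerPart_x_smul (n : M →ₗ[ℝ] ℝ) (m : M) : lowerPart n (genX • m) = n (genX • m) := by
  rw [lowerPart_apply, e_x_smul, map_zero, sub_zero]

/-- A map which is of rank one over `ℂ` on `eM` and given by `ψ` on `fM` is a non-zero
endomorphism as soon as it is compatible with `x₁` and `y₁`. -/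
theorem exists_rankOne_end (hM : ∀ m : M, genT • m = 0) (l : M →ₗ[ℝ] ℝ) {w m₀ : M}
    (hw : idemE • w = w) (hw0 : w ≠ 0) (hl : l (idemE • m₀) = 1)
    (ψ : M →ₗ[ℝ] M) (hψe : ∀ m, ψ (idemE • m) = 0) (heψ : ∀ m, idemE • ψ m = 0)
    (hx : ∀ m, l (idemE • m) • genX • w - l (genJ • m) • genX • genJ • w = ψ (genX • m))
    (hy : ∀ m, genY • ψ m = l (genY • m) • w - l (genJ • genY • m) • genJ • w) :
    ∃ g : M →ₗ[A] M, g ≠ 0 ∧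
      ∀ m, g m = l (idemE • m) • w - l (genJ • m) • genJ • w + ψ m := by
  let g : M →ₗ[A] M := homOfGenerators hM hM (rankOne l w + ψ)
    (fun m => by
      simp only [LinearMap.add_apply, hψe, smul_add, heψ, rankOne_apply, e_e_smul, j_e_smul,
        smul_sub, order_smul_real_smul, e_j_smul, hw])
    (fun m => by
      have h : ψ (genJ • m) = 0 := by rw [← e_j_smul, hψe]
      simp only [LinearMap.add_apply, h, smul_add, j_smul_of_e (heψ m), rankOne_apply, e_j_smul,
        j_j_smul, smul_sub, order_smul_real_smul, hw, map_neg, neg_smul, smul_neg]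
      abel)
    (fun m => by
      simp only [LinearMap.add_apply, smul_add, x_smul_of_e (heψ m), rankOne_apply, e_x_smul,
        j_x_smul, map_zero, zero_smul, sub_zero, zero_add, add_zero, smul_sub,
        order_smul_real_smul, hx])
    (fun m => by
      have h : ψ (genY • m) = 0 := by rw [← e_y_smul, hψe]
      simp only [LinearMap.add_apply, h, smul_add, rankOne_apply, e_y_smul, smul_sub,
        order_smul_real_smul, y_smul_of_e hw, y_j_smul, smul_zero, sub_zero, add_zero, zero_add,
        hy])
  have hg : ∀ m, g m = l (idemE • m) • w - l (genJ • m) • genJ • w + ψ m := fun _ => rfl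
  refine ⟨g, fun h => ?_, hg⟩
  -- At `em₀` the coefficient of `w` is `l(em₀) = 1`, and `w`, `ȷw` are independent.
  have h1 := hg (idemE • m₀)
  rw [h, hψe, e_e_smul, hl, add_zero, LinearMap.zero_apply, sub_eq_add_neg, ← neg_smul] at h1
  exact one_ne_zero (eq_zero_of_smul_add_smul_j hw hw0 h1.symm).1

/-- On a Schurian module, `x₁` or `y₁` acts by zero. -/
theorem IsSchurian.x_or_y_eq_zero [FiniteDimensional ℝ M] (h : IsSchurian M) :
    (∀ m : M, genX • m = 0) ∨ ∀ m : M, genY • m = 0 := by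
  by_contra! hc
  obtain ⟨⟨m₀, hx⟩, m₁, hy⟩ := hc
  have hM := h.genT_smul
  obtain ⟨l, hl⟩ := exists_functional_of_ne_zero hx
  -- With real part `l ∘ x₁` and target `w = y₁m₁`, both compatibility conditions reduce to `x₁y₁ =
  -- 0` and `x₁ȷy₁ = 0`. By the same relations the resulting `g` kills `w`, against injectivity.
  let l' : M →ₗ[ℝ] ℝ := l ∘ₗ Algebra.lsmul ℝ ℝ M genX
  have hl' : ∀ m, l' m = l (genX • m) := fun _ => rfl
  obtain ⟨g, hg0, hg⟩ := exists_rankOne_end hM l' (m₀ := m₀) (e_y_smul m₁) hy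
    (by rw [hl', x_e_smul, hl]) 0 (fun _ => rfl) (fun _ => smul_zero _)
    (fun m => by simp [x_y_smul hM, x_j_y_smul])
    (fun m => by simp [hl', x_y_smul hM, x_j_y_smul])
  apply hy
  apply (h.bijective hg0).injective
  rw [map_zero, hg, hl', hl', e_y_smul, x_y_smul hM, x_j_y_smul]
  simp

theorem e_smul_plane {w : M} (hw : idemE • w = w) (p : ℝ × ℝ) :
    idemE • plane w p = plane w p := by
  simp only [plane_apply, smul_add, order_smul_real_smul, e_j_smul, hw]

theorem j_smul_plane {w : M} (hw : idemE • w = w) (p : ℝ × ℝ) :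
    genJ • plane w p = plane w (-p.2, p.1) := by
  simp only [plane_apply, smul_add, order_smul_real_smul, j_j_smul, hw, neg_smul, smul_neg]
  abel

theorem plane_eq_zero {w : M} (hw : idemE • w = w) (hw0 : w ≠ 0) {p : ℝ × ℝ}
    (h : plane w p = 0) : p = 0 :=
  Prod.ext_iff.mpr (eq_zero_of_smul_add_smul_j hw hw0 h)

end

/-! ### The maps `X` and `Y` of the six diagrams -/

theorem Diagram.X_eq_zero {D : Diagram} (h₁ : D.X₁ = 0) (h₂ : D.X₂ = 0) : D.X = 0 := by
  ext <;> simp [Diagram.X, h₁, h₂]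

theorem Diagram.Y_eq_zero {D : Diagram} (h₁ : D.Y₁ = 0) (h₂ : D.Y₂ = 0) : D.Y = 0 := by
  ext <;> simp [Diagram.Y, h₁, h₂]

theorem diagS_X : diagS.X = 0 := Diagram.X_eq_zero rfl rfl
theorem diagT_X : diagT.X = 0 := Diagram.X_eq_zero rfl rfl
theorem diagY₁_X : diagY₁.X = 0 := Diagram.X_eq_zero rfl rfl
theorem diagY₂_X : diagY₂.X = 0 := Diagram.X_eq_zero rfl rfl
theorem diagS_Y : diagS.Y = 0 := Diagram.Y_eq_zero rfl rfl
theorem diagT_Y : diagT.Y = 0 := Diagram.Y_eq_zero rfl rfl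
theorem diagX₁_Y : diagX₁.Y = 0 := Diagram.Y_eq_zero rfl rfl
theorem diagX₂_Y : diagX₂.Y = 0 := Diagram.Y_eq_zero rfl rfl
theorem diagX₁_X (w : ℝ × ℝ) : diagX₁.X w = w.1 := by
  change w.1 + (0 : ℝ) = w.1
  rw [add_zero]
theorem diagX₂_X (w : ℝ × ℝ) : diagX₂.X w = w := by
  change ((w.1, 0) : ℝ × ℝ) + (0, w.2) = w
  simp

/-! ### Homomorphisms out of the six modules -/

section Lifts

theorem eq_zero_of_add_eq_zero {M : Type*} [AddCommGroup M] [Module A M] {w v : M}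
    (hw : idemE • w = w) (hv : idemE • v = 0) (h : w + v = 0) : w = 0 ∧ v = 0 := by
  have hw0 : w = 0 := by
    have h1 : idemE • (w + v) = 0 := by rw [h, smul_zero]
    rwa [smul_add, hw, hv, add_zero] at h1
  exact ⟨hw0, by rwa [hw0, zero_add] at h⟩

/-- The map `(p, q) ↦ pu + qv`. -/
def combination {M : Type*} [AddCommGroup M] [Module ℝ M] (u v : M) : ℝ × ℝ →ₗ[ℝ] M :=
  (LinearMap.toSpanSingleton ℝ M u).coprod (LinearMap.toSpanSingleton ℝ M v)

theorem combination_apply {M : Type*} [AddCommGroup M] [Module ℝ M] (u v : M) (p : ℝ × ℝ) :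
    combination u v p = p.1 • u + p.2 • v := rfl

variable {M : Type*} [AddCommGroup M] [Module ℝ M] [Module A M] [IsScalarTower ℝ A M]

theorem smul_plane (a : A) (w : M) (p : ℝ × ℝ) :
    a • plane w p = p.1 • a • w + p.2 • a • genJ • w := by
  rw [plane_apply, smul_add, order_smul_real_smul, order_smul_real_smul]

theorem smul_combination (a : A) (u v : M) (p : ℝ × ℝ) :
    a • combination u v p = combination (a • u) (a • v) p := by
  simp only [combination_apply, smul_add, order_smul_real_smul]

theorem smul_combination_eq_zero {a : A} {u v : M} (hu : a • u = 0) (hv : a • v = 0) (p : ℝ × ℝ) :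
    a • combination u v p = 0 := by
  rw [smul_combination, hu, hv, combination_apply, smul_zero, smul_zero, add_zero]

theorem smul_plane_eq_zero {a : A} {w : M} (h : a • w = 0) (hj : a • genJ • w = 0) (p : ℝ × ℝ) :
    a • plane w p = 0 := by
  rw [smul_plane, h, hj, smul_zero, smul_zero, add_zero]

theorem order_smul_real_smul_eq_zero {a : A} {v : M} (h : a • v = 0) (c : ℝ) : a • c • v = 0 := by
  rw [order_smul_real_smul, h, smul_zero]

/-- The homomorphism from `diagS.Mod` given by a vector of `eM` killed by `x₁` and `x₁ȷ`. -/
def liftS (hM : ∀ m : M, genT • m = 0) {w : M} (hw : idemE • w = w) (hx : genX • w = 0)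
    (hxj : genX • genJ • w = 0) : diagS.Mod →ₗ[A] M :=
  Diagram.lift (D := diagS) (Or.inl diagS_X) hM (plane w) 0
    (e_smul_plane hw) (fun _ => smul_zero _) (j_smul_plane hw) (smul_plane_eq_zero hx hxj)
    (fun _ => (smul_zero _).trans (map_zero (plane w)).symm)

/-- The homomorphism from `diagT.Mod` given by a vector of `fM` killed by `y₁`. -/
def liftT (hM : ∀ m : M, genT • m = 0) {v : M} (hv : idemE • v = 0) (hy : genY • v = 0) :
    diagT.Mod →ₗ[A] M :=
  Diagram.lift (D := diagT) (Or.inl diagT_X) hM 0 (LinearMap.toSpanSingleton ℝ M v)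
    (fun _ => smul_zero _) (order_smul_real_smul_eq_zero hv) (fun _ => smul_zero _)
    (fun p => by
      rw [diagT_X]
      exact (smul_zero _).trans (map_zero (LinearMap.toSpanSingleton ℝ M v)).symm)
    (order_smul_real_smul_eq_zero hy)

/-- The homomorphism from `diagY₁.Mod` given by a vector of `fM`. -/
def liftY₁ (hM : ∀ m : M, genT • m = 0) {v : M} (hv : idemE • v = 0) : diagY₁.Mod →ₗ[A] M :=
  Diagram.lift (D := diagY₁) (Or.inl diagY₁_X) hM (plane (genY • v))
    (LinearMap.toSpanSingleton ℝ M v) (e_smul_plane (e_y_smul v))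
    (order_smul_real_smul_eq_zero hv) (j_smul_plane (e_y_smul v))
    (fun p => by
      rw [diagY₁_X]
      exact (smul_plane_eq_zero (x_y_smul hM v) (x_j_y_smul v) p).trans
        (map_zero (LinearMap.toSpanSingleton ℝ M v)).symm)
    (fun (c : ℝ) => show genY • c • v = plane (genY • v) (c, 0) by
      rw [order_smul_real_smul, plane_apply, zero_smul, add_zero])

/-- The homomorphism from `diagX₁.Mod` given by a vector of `eM` killed by `x₁ȷ` and `y₁x₁`. -/
def liftX₁ (hM : ∀ m : M, genT • m = 0) {w : M} (hw : idemE • w = w)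
    (hxj : genX • genJ • w = 0) (hyx : genY • genX • w = 0) : diagX₁.Mod →ₗ[A] M :=
  Diagram.lift (D := diagX₁) (Or.inr diagX₁_Y) hM (plane w)
    (LinearMap.toSpanSingleton ℝ M (genX • w)) (e_smul_plane hw)
    (order_smul_real_smul_eq_zero (e_x_smul w)) (j_smul_plane hw)
    (fun (p : ℝ × ℝ) => show genX • plane w p = (p.1 + (0 : ℝ)) • genX • w by
      rw [smul_plane, hxj, smul_zero, add_zero, add_zero])
    (fun c => by
      rw [diagX₁_Y]
      exact (order_smul_real_smul_eq_zero hyx c).trans (map_zero (plane w)).symm)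

/-- The homomorphism from `diagY₂.Mod` given by vectors `u, v` of `fM` with `y₁v = ȷy₁u`. -/
def liftY₂ (hM : ∀ m : M, genT • m = 0) {u v : M} (hu : idemE • u = 0) (hv : idemE • v = 0)
    (huv : genY • v = genJ • genY • u) : diagY₂.Mod →ₗ[A] M :=
  Diagram.lift (D := diagY₂) (Or.inl diagY₂_X) hM (plane (genY • u)) (combination u v)
    (e_smul_plane (e_y_smul u)) (smul_combination_eq_zero hu hv) (j_smul_plane (e_y_smul u))
    (fun p => by
      rw [diagY₂_X]
      exact (smul_plane_eq_zero (x_y_smul hM u) (x_j_y_smul u) p).trans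
        (map_zero (combination u v)).symm)
    (fun (c : ℝ × ℝ) => show genY • combination u v c = plane (genY • u) c by
      rw [smul_combination, huv]; rfl)

/-- The homomorphism from `diagX₂.Mod` given by a vector of `eM` killed by `y₁x₁` and `y₁x₁ȷ`. -/
def liftX₂ (hM : ∀ m : M, genT • m = 0) {w : M} (hw : idemE • w = w)
    (hyx : genY • genX • w = 0) (hyxj : genY • genX • genJ • w = 0) : diagX₂.Mod →ₗ[A] M :=
  Diagram.lift (D := diagX₂) (Or.inr diagX₂_Y) hM (plane w)
    (combination (genX • w) (genX • genJ • w)) (e_smul_plane hw)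
    (smul_combination_eq_zero (e_x_smul w) (e_x_smul _)) (j_smul_plane hw)
    (fun (p : ℝ × ℝ) =>
      show genX • plane w p = combination (genX • w) (genX • genJ • w) ((p.1, 0) + (0, p.2)) by
      rw [smul_plane, combination_apply]; simp)
    (fun c => by
      rw [diagX₂_Y]
      exact (smul_combination_eq_zero hyx hyxj c).trans (map_zero (plane w)).symm)

end Lifts

/-! ### Identifying a Schurian module with one of the six -/

section Classification

variable {M : Type*} [AddCommGroup M] [Module ℝ M] [Module A M] [IsScalarTower ℝ A M]
  [FiniteDimensional ℝ M]

theorem IsSchurian.equiv_of_x_y_eq_zero (h : IsSchurian M) (hx : ∀ m : M, genX • m = 0)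
    (hy : ∀ m : M, genY • m = 0) :
    Nonempty (M ≃ₗ[A] diagS.Mod) ∨ Nonempty (M ≃ₗ[A] diagT.Mod) := by
  have hM := h.genT_smul
  by_cases he : ∀ m : M, idemE • m = 0
  · right
    obtain ⟨v, hv⟩ := @exists_ne _ h.nontrivial (0 : M)
    obtain ⟨l, hl⟩ := exists_functional_of_ne_zero hv
    let g : M →ₗ[A] M := homOfGenerators hM hM (l.smulRight v)
      (fun m => by rw [he, he, map_zero])
      (fun m => by rw [j_smul_of_e (he _), j_smul_of_e (he _), map_zero])
      (fun m => by rw [hx, hx, map_zero])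
      (fun m => by rw [hy, hy, map_zero])
    have hg : ∀ m, g m = l m • v := fun _ => rfl
    refine h.equiv_of_range (g := g) (L := liftT hM (he v) (hy v)) (fun h0 => hv ?_)
      (fun n hn => ?_) (fun m => ?_)
    · have := hg v
      rwa [h0, hl, one_smul, LinearMap.zero_apply, eq_comm] at this
    · have key : ∀ c : ℝ, 0 + c • v = 0 → c = 0 := fun c hc =>
        (smul_eq_zero.mp ((zero_add _).symm.trans hc)).resolve_right hv
      exact Diagram.mod_ext rfl (key _ hn)
    · exact ⟨diagT.pair 0 (l m), (zero_add _).trans (hg m).symm⟩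
  · left
    push Not at he
    obtain ⟨m₀, hm₀⟩ := he
    obtain ⟨l, hl⟩ := exists_functional_of_ne_zero hm₀
    obtain ⟨g, hg0, hg⟩ := exists_rankOne_end hM l (m₀ := m₀) (e_e_smul m₀) hm₀ hl 0
      (fun _ => rfl) (fun _ => smul_zero _) (fun m => by simp [hx]) (fun m => by simp [hy])
    refine h.equiv_of_range hg0 (L := liftS hM (e_e_smul m₀) (hx _) (hx _))
      (fun n hn => ?_) (fun m => ?_)
    · have hn' : plane (idemE • m₀) (diagS.projW n) = 0 := (add_zero _).symm.trans hn
      exact Diagram.mod_ext (plane_eq_zero (e_e_smul m₀) hm₀ hn') rfl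
    · have key : plane (idemE • m₀) (l (idemE • m), -l (genJ • m)) + 0 = g m := by
        rw [hg, plane_apply, LinearMap.zero_apply, neg_smul, ← sub_eq_add_neg]
      exact ⟨diagS.pair (l (idemE • m), -l (genJ • m)) 0, key⟩

/-- To extend `m ↦ Λ(m)w` from `eM` to `fM`, one must lift `Λ(y₁m)w` through `y₁`. This is possible
if `w` and `ȷw` both lie in the image of `y₁`, or if `w` does and `Λ` is real on that image. -/
theorem IsSchurian.equiv_of_x_eq_zero (h : IsSchurian M) (hx : ∀ m : M, genX • m = 0)
    {m₀ : M} (hy : genY • m₀ ≠ 0) :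
    Nonempty (M ≃ₗ[A] diagY₁.Mod) ∨ Nonempty (M ≃ₗ[A] diagY₂.Mod) := by
  have hM := h.genT_smul
  -- Either the image of `y₁` contains a complex line, or it is totally real.
  by_cases hc : ∃ m₁ m₂ : M, genY • m₂ = genJ • genY • m₁ ∧ genY • m₁ ≠ 0
  · right
    obtain ⟨m₁, m₂, hm, hm1⟩ := hc
    obtain ⟨u, hu, hyu⟩ : ∃ u : M, idemE • u = 0 ∧ genY • u = genY • m₁ :=
      ⟨_, e_smul_lower m₁, y_smul_lower m₁⟩
    obtain ⟨v, hv, hyv⟩ : ∃ v : M, idemE • v = 0 ∧ genY • v = genY • m₂ :=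
      ⟨_, e_smul_lower m₂, y_smul_lower m₂⟩
    rw [← hyu, ← hyv] at hm
    rw [← hyu] at hm1
    obtain ⟨l, hl⟩ := exists_functional_of_ne_zero hm1
    let ψ : M →ₗ[ℝ] M := (l ∘ₗ Algebra.lsmul ℝ ℝ M genY).smulRight u
      - (l ∘ₗ Algebra.lsmul ℝ ℝ M (genJ * genY)).smulRight v
    have hψ : ∀ m, ψ m = l (genY • m) • u - l (genJ • genY • m) • v := fun m => by
      rw [smul_smul]; rfl
    obtain ⟨g, hg0, hg⟩ := exists_rankOne_end hM l (m₀ := genY • u) (e_y_smul u) hm1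
      (by rw [e_y_smul, hl]) ψ
      (fun m => by simp [hψ, y_e_smul])
      (fun m => by simp [hψ, smul_sub, order_smul_real_smul, hu, hv])
      (fun m => by simp [hx])
      (fun m => by rw [hψ, smul_sub, order_smul_real_smul, order_smul_real_smul, hm])
    refine h.equiv_of_range hg0 (L := liftY₂ hM hu hv hm) (fun n hn => ?_) (fun m => ?_)
    · obtain ⟨h1, h2⟩ := eq_zero_of_add_eq_zero (e_smul_plane (e_y_smul u) _)
        (smul_combination_eq_zero hu hv _) hn
      -- Since `y₁v = ȷy₁u`, applying `y₁` transfers independence from `y₁u, ȷy₁u` to `u, v`.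
      have key : ∀ c : ℝ × ℝ, combination u v c = 0 → plane (genY • u) c = 0 := fun c hc => by
        have h3 : genY • combination u v c = 0 := by rw [hc, smul_zero]
        rwa [smul_combination, hm] at h3
      exact Diagram.mod_ext (plane_eq_zero (e_y_smul u) hm1 h1)
        (plane_eq_zero (e_y_smul u) hm1 (key _ h2))
    · have key : plane (genY • u) (l (idemE • m), -l (genJ • m))
          + combination u v (l (genY • m), -l (genJ • genY • m)) = g m := by
        rw [hg, hψ, plane_apply, combination_apply]
        simp only [neg_smul, ← sub_eq_add_neg]
      exact ⟨diagY₂.pair (l (idemE • m), -l (genJ • m)) (l (genY • m), -l (genJ • genY • m)), key⟩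
  · left
    push Not at hc
    obtain ⟨v, hv, hyv⟩ : ∃ v : M, idemE • v = 0 ∧ genY • v = genY • m₀ :=
      ⟨_, e_smul_lower m₀, y_smul_lower m₀⟩
    rw [← hyv] at hy
    have hP : genY • v ∉ LinearMap.range (Algebra.lsmul ℝ ℝ M (genJ * genY)) := by
      rintro ⟨m, hm⟩
      have hm' : genY • v = genJ • genY • m := by rw [smul_smul]; exact hm.symm
      have h1 := hc m v hm'
      rw [h1, smul_zero] at hm'
      exact hy hm'
    -- Vanishing of `l` on `ȷ · im y₁` means that `Λ` is real on `im y₁`, so the single lift `v` of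
    -- `y₁v` suffices.
    obtain ⟨l, hl, hlP⟩ := exists_functional hP
    have hlJ : ∀ m, l (genJ • genY • m) = 0 := fun m => by
      rw [smul_smul]; exact hlP _ ⟨m, rfl⟩
    let ψ : M →ₗ[ℝ] M := (l ∘ₗ Algebra.lsmul ℝ ℝ M genY).smulRight v
    have hψ : ∀ m, ψ m = l (genY • m) • v := fun m => rfl
    obtain ⟨g, hg0, hg⟩ := exists_rankOne_end hM l (m₀ := genY • v) (e_y_smul v) hy
      (by rw [e_y_smul, hl]) ψ
      (fun m => by simp [hψ, y_e_smul])
      (fun m => by simp [hψ, order_smul_real_smul, hv])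
      (fun m => by simp [hx])
      (fun m => by rw [hψ, order_smul_real_smul, hlJ, zero_smul, sub_zero])
    refine h.equiv_of_range hg0 (L := liftY₁ hM hv) (fun n hn => ?_) (fun m => ?_)
    · obtain ⟨h1, h2⟩ := eq_zero_of_add_eq_zero (e_smul_plane (e_y_smul v) _)
        (order_smul_real_smul_eq_zero hv _) hn
      refine Diagram.mod_ext (plane_eq_zero (e_y_smul v) hy h1)
        ((smul_eq_zero.mp h2).resolve_right fun h0 => hy ?_)
      rw [h0, smul_zero]
    · have key : plane (genY • v) (l (idemE • m), -l (genJ • m)) + l (genY • m) • v = g m := by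
        rw [hg, hψ, plane_apply]
        simp only [neg_smul, ← sub_eq_add_neg]
      exact ⟨diagY₁.pair (l (idemE • m), -l (genJ • m)) (l (genY • m)), key⟩

/-- Extending `m ↦ Λ(m)w` to `fM` requires `x₁(Λ(m)w)` to depend only on `x₁m`. This holds if `x₁`
is injective on `eM`, or if `x₁w = 0` and the imaginary part of `Λ` vanishes on `ker x₁`. -/
theorem IsSchurian.equiv_of_y_eq_zero (h : IsSchurian M) (hy : ∀ m : M, genY • m = 0)
    {m₀ : M} (hx : genX • m₀ ≠ 0) :
    Nonempty (M ≃ₗ[A] diagX₁.Mod) ∨ Nonempty (M ≃ₗ[A] diagX₂.Mod) := by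
  have hM := h.genT_smul
  -- The kernel of `x₁` on `eM` is totally real: were `x₁` zero on a complex line, a rank one map
  -- onto it, extended by zero on `fM`, would be an endomorphism killing `x₁m₀ ≠ 0`.
  have hinter : ∀ n : M, idemE • n = n → n ≠ 0 → genX • n = 0 → genX • genJ • n ≠ 0 := by
    intro n hn hn0 hxn hxjn
    obtain ⟨l, hl⟩ := exists_functional_of_ne_zero hn0
    obtain ⟨g, hg0, hg⟩ := exists_rankOne_end hM l (m₀ := n) hn hn0 (by rw [hn, hl]) 0
      (fun _ => rfl) (fun _ => smul_zero _) (fun m => by simp [hxn, hxjn])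
      (fun m => by simp [hy])
    apply hx
    apply (h.bijective hg0).injective
    rw [map_zero, hg, e_x_smul, j_x_smul]
    simp
  by_cases hc : ∃ n : M, idemE • n = n ∧ n ≠ 0 ∧ genX • n = 0
  · left
    obtain ⟨n, hn, hn0, hxn⟩ := hc
    have hxjn := hinter n hn hn0 hxn
    have hP : n ∉ (LinearMap.ker (Algebra.lsmul ℝ ℝ M genX)).map (Algebra.lsmul ℝ ℝ M genJ) := by
      rintro ⟨m, hm, hmn⟩
      have hm' : genX • m = 0 := hm
      have hmn' : genJ • m = n := hmn
      apply hxjn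
      rw [← hmn', j_j_smul, smul_neg, x_e_smul, hm', neg_zero]
    obtain ⟨l, hl, hlP⟩ := exists_functional hP
    -- As `l` vanishes on `ȷ · ker x₁`, the functional `m ↦ l(ȷm)` depends only on `x₁m`.
    obtain ⟨ν, hν⟩ := exists_factor (l ∘ₗ Algebra.lsmul ℝ ℝ M genJ) (Algebra.lsmul ℝ ℝ M genX)
      (fun m hm => hlP _ ⟨m, hm, rfl⟩)
    replace hν : ∀ m, l (genJ • m) = ν (genX • m) := hν
    -- Forced on the image of `x₁`: because `x₁n = 0`, the vector `x₁(Λ(m)n)` equals `-l(ȷm)x₁ȷn`.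
    -- Passing to `lowerPart` makes the map vanish on `eM`.
    let ψ : M →ₗ[ℝ] M := -(lowerPart ν).smulRight (genX • genJ • n)
    have hψ : ∀ m, ψ m = -(lowerPart ν m • genX • genJ • n) := fun _ => rfl
    obtain ⟨g, hg0, hg⟩ := exists_rankOne_end hM l (m₀ := n) hn hn0 (by rw [hn, hl]) ψ
      (fun m => by simp [hψ, lowerPart_e_smul])
      (fun m => by simp [hψ, order_smul_real_smul, e_x_smul])
      (fun m => by rw [hψ, hν, hxn, lowerPart_x_smul, smul_zero, zero_sub])
      (fun m => by simp [hy])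
    have hjj : genJ • genJ • n = -n := by rw [j_j_smul, hn]
    -- In `diagX₁` the map `X` kills `ȷw`, not `w`; hence `w = ȷn`, for which `ȷw = -n`. This also
    -- explains the signs and the swapped coordinates in the preimage below.
    refine h.equiv_of_range hg0 (L := liftX₁ hM (w := genJ • n) (e_j_smul n)
      (by rw [hjj, smul_neg, hxn, neg_zero]) (hy _)) (fun k hk => ?_) (fun m => ?_)
    · obtain ⟨h1, h2⟩ := eq_zero_of_add_eq_zero (e_smul_plane (e_j_smul n) _)
        (order_smul_real_smul_eq_zero (e_x_smul _) _) hk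
      refine Diagram.mod_ext (plane_eq_zero (e_j_smul n) (fun h0 => hxjn ?_) h1)
        ((smul_eq_zero.mp h2).resolve_right hxjn)
      rw [h0, smul_zero]
    · have key : plane (genJ • n) (-l (genJ • m), -l (idemE • m))
          + (-lowerPart ν m) • genX • genJ • n = g m := by
        rw [hg, hψ, plane_apply]
        simp only [hjj, neg_smul, smul_neg, neg_neg]
        abel
      exact ⟨diagX₁.pair (-l (genJ • m), -l (idemE • m)) (-lowerPart ν m), key⟩
  · right
    push Not at hc
    have hinj : ∀ n : M, idemE • n = n → genX • n = 0 → n = 0 := fun n hn hxn => by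
      by_contra hn0
      exact hc n hn hn0 hxn
    obtain ⟨w, hw, hw0⟩ : ∃ w : M, idemE • w = w ∧ w ≠ 0 :=
      ⟨idemE • m₀, e_e_smul m₀, fun h0 => hx (by rw [← x_e_smul, h0, smul_zero])⟩
    obtain ⟨l, hl⟩ := exists_functional_of_ne_zero hw0
    -- Injectivity of `x₁` on `eM` lets both the real and the imaginary part of `Λ` factor through
    -- `x₁`.
    have hker : ∀ m : M, genX • m = 0 → idemE • m = 0 := fun m hm =>
      hinj _ (e_e_smul m) (by rw [x_e_smul, hm])
    obtain ⟨μ, hμ⟩ := exists_factor (l ∘ₗ Algebra.lsmul ℝ ℝ M idemE) (Algebra.lsmul ℝ ℝ M genX)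
      (fun m hm => (congrArg l (hker m hm)).trans (map_zero l))
    obtain ⟨ν, hν⟩ := exists_factor (l ∘ₗ Algebra.lsmul ℝ ℝ M genJ) (Algebra.lsmul ℝ ℝ M genX)
      (fun m hm => (congrArg l (j_smul_of_e (hker m hm))).trans (map_zero l))
    replace hμ : ∀ m, l (idemE • m) = μ (genX • m) := hμ
    replace hν : ∀ m, l (genJ • m) = ν (genX • m) := hν
    let ψ : M →ₗ[ℝ] M := (lowerPart μ).smulRight (genX • w)
      - (lowerPart ν).smulRight (genX • genJ • w)
    have hψ : ∀ m, ψ m = lowerPart μ m • genX • w - lowerPart ν m • genX • genJ • w :=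
      fun _ => rfl
    obtain ⟨g, hg0, hg⟩ := exists_rankOne_end hM l (m₀ := w) hw hw0 (by rw [hw, hl]) ψ
      (fun m => by simp [hψ, lowerPart_e_smul])
      (fun m => by simp [hψ, smul_sub, order_smul_real_smul, e_x_smul])
      (fun m => by rw [hψ, hμ, hν, lowerPart_x_smul, lowerPart_x_smul])
      (fun m => by simp [hy])
    refine h.equiv_of_range hg0 (L := liftX₂ hM hw (hy _) (hy _)) (fun k hk => ?_) (fun m => ?_)
    · obtain ⟨h1, h2⟩ := eq_zero_of_add_eq_zero (e_smul_plane hw _)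
        (smul_combination_eq_zero (e_x_smul _) (e_x_smul _) _) hk
      exact Diagram.mod_ext (plane_eq_zero hw hw0 h1)
        (plane_eq_zero hw hw0 (hinj _ (e_smul_plane hw _) ((smul_plane _ _ _).trans h2)))
    · have key : plane w (l (idemE • m), -l (genJ • m))
          + combination (genX • w) (genX • genJ • w) (lowerPart μ m, -lowerPart ν m) = g m := by
        rw [hg, hψ, plane_apply, combination_apply]
        simp only [neg_smul, ← sub_eq_add_neg]
      exact ⟨diagX₂.pair (l (idemE • m), -l (genJ • m)) (lowerPart μ m, -lowerPart ν m), key⟩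

theorem IsSchurian.exists_equiv (h : IsSchurian M) :
    ∃ i, Nonempty (M ≃ₗ[A] (sixDiagrams i).Mod) := by
  by_cases hx : ∀ m : M, genX • m = 0
  · by_cases hy : ∀ m : M, genY • m = 0
    · rcases h.equiv_of_x_y_eq_zero hx hy with hi | hi
      exacts [⟨0, hi⟩, ⟨1, hi⟩]
    · push Not at hy
      obtain ⟨m₀, hy⟩ := hy
      rcases h.equiv_of_x_eq_zero hx hy with hi | hi
      exacts [⟨2, hi⟩, ⟨4, hi⟩]
  · have hy := h.x_or_y_eq_zero.resolve_left hx
    push Not at hx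
    obtain ⟨m₀, hx⟩ := hx
    rcases h.equiv_of_y_eq_zero hy hx with hi | hi
    exacts [⟨3, hi⟩, ⟨5, hi⟩]

end Classification

/-! ### Homomorphisms between modules of diagrams -/

namespace Diagram

/-- The homomorphism of modules given by linear maps between two diagrams. -/
def map {D D' : Diagram} (h : D.X = 0 ∨ D.Y = 0) (h' : D'.X = 0 ∨ D'.Y = 0)
    (α : (D.U × D.U) →ₗ[ℝ] D'.U × D'.U) (β : D.V →ₗ[ℝ] D'.V)
    (hJ : ∀ w, D'.J (α w) = α (D.J w)) (hX : ∀ w, D'.X (α w) = β (D.X w))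
    (hY : ∀ v, D'.Y (β v) = α (D.Y v)) : D.Mod →ₗ[A] D'.Mod :=
  homOfGenerators (D.genT_smul h) (D'.genT_smul h')
    (show D.Mod →ₗ[ℝ] D'.Mod from (α ∘ₗ D.projW).prod (β ∘ₗ D.projV))
    (fun m => mod_ext
      (show α (D.projW (idemE • m)) = D'.projW (idemE • D'.pair (α (D.projW m)) (β (D.projV m))) by
        simp [idemE_smul])
      (show β (D.projV (idemE • m)) = D'.projV (idemE • D'.pair (α (D.projW m)) (β (D.projV m))) by
        simp [idemE_smul]))
    (fun m => mod_ext
      (show α (D.projW (genJ • m)) = D'.projW (genJ • D'.pair (α (D.projW m)) (β (D.projV m))) by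
        simp [genJ_smul, hJ])
      (show β (D.projV (genJ • m)) = D'.projV (genJ • D'.pair (α (D.projW m)) (β (D.projV m))) by
        simp [genJ_smul]))
    (fun m => mod_ext
      (show α (D.projW (genX • m)) = D'.projW (genX • D'.pair (α (D.projW m)) (β (D.projV m))) by
        simp [genX_smul])
      (show β (D.projV (genX • m)) = D'.projV (genX • D'.pair (α (D.projW m)) (β (D.projV m))) by
        simp [genX_smul, hX]))
    (fun m => mod_ext
      (show α (D.projW (genY • m)) = D'.projW (genY • D'.pair (α (D.projW m)) (β (D.projV m))) by
        simp [genY_smul, hY])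
      (show β (D.projV (genY • m)) = D'.projV (genY • D'.pair (α (D.projW m)) (β (D.projV m))) by
        simp [genY_smul]))

theorem map_apply {D D' : Diagram} (h : D.X = 0 ∨ D.Y = 0) (h' : D'.X = 0 ∨ D'.Y = 0)
    (α : (D.U × D.U) →ₗ[ℝ] D'.U × D'.U) (β : D.V →ₗ[ℝ] D'.V)
    (hJ : ∀ w, D'.J (α w) = α (D.J w)) (hX : ∀ w, D'.X (α w) = β (D.X w))
    (hY : ∀ v, D'.Y (β v) = α (D.Y v)) (m : D.Mod) :
    map h h' α β hJ hX hY m = D'.pair (α (D.projW m)) (β (D.projV m)) := rfl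

/-- Length is additive in exact sequences of diagrams. -/
theorem length_eq_add {D D' D'' : Diagram} {f : D.Mod →ₗ[A] D'.Mod} {g : D'.Mod →ₗ[A] D''.Mod}
    {α : D.U × D.U → D'.U × D'.U} {β : D.V → D'.V}
    {α' : D'.U × D'.U → D''.U × D''.U} {β' : D'.V → D''.V}
    (hf : ∀ m, f m = D'.pair (α (D.projW m)) (β (D.projV m)))
    (hg : ∀ m, g m = D''.pair (α' (D'.projW m)) (β' (D'.projV m)))
    (hα : Function.Injective α) (hβ : Function.Injective β)
    (hα' : Function.Surjective α') (hβ' : Function.Surjective β')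
    (hαα' : Function.Exact α α') (hββ' : Function.Exact β β') :
    Module.length A D'.Mod = Module.length A D.Mod + Module.length A D''.Mod := by
  refine Module.length_eq_add_of_exact f g (fun m n hmn => ?_) (fun m => ?_) (fun m => ?_)
  · rw [hf, hf] at hmn
    exact mod_ext (hα (congrArg D'.projW hmn)) (hβ (congrArg D'.projV hmn))
  · obtain ⟨w, hw⟩ := hα' (D''.projW m)
    obtain ⟨v, hv⟩ := hβ' (D''.projV m)
    exact ⟨D'.pair w v, (hg _).trans (mod_ext hw hv)⟩
  · rw [hg]
    constructor
    · intro h0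
      obtain ⟨w, hw⟩ := (hαα' _).mp (congrArg D''.projW h0)
      obtain ⟨v, hv⟩ := (hββ' _).mp (congrArg D''.projV h0)
      exact ⟨D.pair w v, (hf _).trans (mod_ext hw hv)⟩
    · rintro ⟨n, rfl⟩
      rw [hf]
      exact mod_ext ((hαα' _).mpr ⟨_, rfl⟩) ((hββ' _).mpr ⟨_, rfl⟩)

end Diagram

/-- This and the next lemma supply exactness in the component where one end of the sequence
vanishes. -/
theorem exact_of_surjective_of_subsingleton {P Q N : Type*} [Zero N] [Subsingleton N] {α : P → Q}
    (h : Function.Surjective α) (β : Q → N) : Function.Exact α β :=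
  fun q => ⟨fun _ => h q, fun _ => Subsingleton.elim _ _⟩

theorem exact_of_subsingleton_of_injective {P Q N : Type*} [AddCommGroup P] [Subsingleton P]
    [AddCommGroup Q] [AddCommGroup N] (α : P →+ Q) {β : Q →+ N}
    (h : Function.Injective β) : Function.Exact α β := by
  intro q
  constructor
  · intro hq
    exact ⟨0, by rw [map_zero, h (hq.trans (map_zero β).symm)]⟩
  · rintro ⟨p, rfl⟩
    rw [Subsingleton.elim p 0, map_zero, map_zero]

instance : Subsingleton diagT.U := inferInstanceAs (Subsingleton PUnit)
instance : Subsingleton diagS.V := inferInstanceAs (Subsingleton PUnit)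

/-! ### The simple modules -/

theorem isSimpleModule_diagS : IsSimpleModule A diagS.Mod := by
  rw [isSimpleModule_iff_toSpanSingleton_surjective]
  refine ⟨⟨diagS.pair ((1 : ℝ), (0 : ℝ)) 0, 0, fun h => one_ne_zero (α := ℝ) ?_⟩,
    fun m hm n => ?_⟩
  · exact congrArg (fun k : diagS.Mod => (diagS.projW k).1) h
  · obtain ⟨p, hp⟩ : ∃ p : ℝ × ℝ, p = diagS.projW m := ⟨_, rfl⟩
    obtain ⟨q, hq⟩ : ∃ q : ℝ × ℝ, q = diagS.projW n := ⟨_, rfl⟩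
    have hp0 : p.1 ^ 2 + p.2 ^ 2 ≠ 0 := by
      intro h0
      refine hm (Diagram.mod_ext (hp.symm.trans (Prod.ext_iff.mpr ⟨?_, ?_⟩)) rfl)
      · exact pow_eq_zero_iff two_ne_zero |>.mp (by nlinarith [sq_nonneg p.1, sq_nonneg p.2])
      · exact pow_eq_zero_iff two_ne_zero |>.mp (by nlinarith [sq_nonneg p.1, sq_nonneg p.2])
    -- `r + si` is the quotient `q / p` of complex numbers, with `ȷ` acting as `i`.
    let r : ℝ := (q.1 * p.1 + q.2 * p.2) / (p.1 ^ 2 + p.2 ^ 2)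
    let s : ℝ := (q.2 * p.1 - q.1 * p.2) / (p.1 ^ 2 + p.2 ^ 2)
    refine ⟨r • idemE + s • genJ, ?_⟩
    rw [LinearMap.toSpanSingleton_apply, add_smul, smul_assoc, smul_assoc, Diagram.idemE_smul,
      Diagram.genJ_smul]
    refine Diagram.mod_ext ?_ rfl
    rw [map_add, map_smul, map_smul, Diagram.projW_pair, Diagram.projW_pair, ← hp, ← hq]
    refine Prod.ext_iff.mpr ⟨?_, ?_⟩
    · change r * p.1 + s * -p.2 = q.1
      simp only [r, s]
      field_simp
      ring
    · change r * p.2 + s * p.1 = q.2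
      simp only [r, s]
      field_simp
      ring

theorem isSimpleModule_diagT : IsSimpleModule A diagT.Mod := by
  rw [isSimpleModule_iff_toSpanSingleton_surjective]
  refine ⟨⟨diagT.pair 0 (1 : ℝ), 0, fun h => one_ne_zero (α := ℝ) ?_⟩, fun m hm n => ?_⟩
  · exact congrArg (fun k : diagT.Mod => diagT.projV k) h
  · obtain ⟨p, hp⟩ : ∃ p : ℝ, p = diagT.projV m := ⟨_, rfl⟩
    obtain ⟨q, hq⟩ : ∃ q : ℝ, q = diagT.projV n := ⟨_, rfl⟩
    have hp0 : p ≠ 0 := fun h0 => hm (Diagram.mod_ext rfl (hp.symm.trans h0))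
    refine ⟨algebraMap ℝ A (q / p), ?_⟩
    rw [LinearMap.toSpanSingleton_apply, algebraMap_smul]
    refine Diagram.mod_ext rfl ?_
    rw [map_smul, ← hp, ← hq]
    exact div_mul_cancel₀ q hp0

theorem finrank_diagS : Module.finrank ℝ diagS.Mod = 2 := by
  change Module.finrank ℝ ((ℝ × ℝ) × PUnit) = 2
  simp [Module.finrank_zero_of_subsingleton]

theorem finrank_diagT : Module.finrank ℝ diagT.Mod = 1 := by
  change Module.finrank ℝ ((PUnit × PUnit) × ℝ) = 1
  simp [Module.finrank_zero_of_subsingleton]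

theorem hasDimVector_diagS : HasDimVector diagS.Mod 1 0 := by
  constructor
  · have h : Algebra.lsmul ℝ ℝ diagS.Mod idemE = LinearMap.id :=
      LinearMap.ext fun m => (Diagram.idemE_smul _ m).trans (Diagram.mod_ext rfl rfl)
    rw [h, LinearMap.range_id, finrank_top, finrank_diagS]
  · have h : Algebra.lsmul ℝ ℝ diagS.Mod idemF = 0 :=
      LinearMap.ext fun m => (Diagram.idemF_smul _ m).trans (Diagram.mod_ext rfl rfl)
    rw [h, LinearMap.range_zero, finrank_bot]

theorem hasDimVector_diagT : HasDimVector diagT.Mod 0 1 := by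
  constructor
  · have h : Algebra.lsmul ℝ ℝ diagT.Mod idemE = 0 :=
      LinearMap.ext fun m => (Diagram.idemE_smul _ m).trans (Diagram.mod_ext rfl rfl)
    rw [h, LinearMap.range_zero, finrank_bot]
  · have h : Algebra.lsmul ℝ ℝ diagT.Mod idemF = LinearMap.id :=
      LinearMap.ext fun m => (Diagram.idemF_smul _ m).trans (Diagram.mod_ext rfl rfl)
    rw [h, LinearMap.range_id, finrank_top, finrank_diagT]

/-! ### Lengths -/

theorem length_diagS : Module.length A diagS.Mod = 1 :=
  Module.length_eq_one_iff.mpr isSimpleModule_diagS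

theorem length_diagT : Module.length A diagT.Mod = 1 :=
  Module.length_eq_one_iff.mpr isSimpleModule_diagT

/-- Extension `0 → S → Y₁ → T → 0`, as the image of `Y` lies in the submodule `U ⊕ U`. -/
theorem length_diagY₁ : Module.length A diagY₁.Mod = 2 := by
  have h := Diagram.length_eq_add
    (Diagram.map_apply (D := diagS) (D' := diagY₁) (Or.inl diagS_X) (Or.inl diagY₁_X)
      LinearMap.id 0 (fun _ => rfl) (fun w => by rw [diagY₁_X]; rfl)
      (fun v => (map_zero diagY₁.Y).trans (Eq.symm (by rw [diagS_Y]; rfl))))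
    (Diagram.map_apply (D := diagY₁) (D' := diagT) (Or.inl diagY₁_X) (Or.inl diagT_X)
      0 LinearMap.id (fun _ => rfl) (fun w => by rw [diagY₁_X, diagT_X]; rfl) (fun _ => rfl))
    Function.injective_id (Function.injective_of_subsingleton _)
    (Function.surjective_to_subsingleton _) Function.surjective_id
    (exact_of_surjective_of_subsingleton Function.surjective_id _)
    (exact_of_subsingleton_of_injective (0 : diagS.V →+ diagY₁.V) (β := AddMonoidHom.id ℝ)
      Function.injective_id)
  rw [h, length_diagS, length_diagT]
  norm_num

/-- Extension `0 → T → X₁ → S → 0`; now `V` is the submodule. -/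
theorem length_diagX₁ : Module.length A diagX₁.Mod = 2 := by
  have h := Diagram.length_eq_add
    (Diagram.map_apply (D := diagT) (D' := diagX₁) (Or.inl diagT_X) (Or.inr diagX₁_Y)
      0 LinearMap.id (fun _ => map_zero diagX₁.J)
      (fun w => (map_zero diagX₁.X).trans (by rw [diagT_X]; rfl))
      (fun v => by rw [diagX₁_Y]; rfl))
    (Diagram.map_apply (D := diagX₁) (D' := diagS) (Or.inr diagX₁_Y) (Or.inl diagS_X)
      LinearMap.id 0 (fun _ => rfl) (fun w => rfl) (fun v => by rw [diagX₁_Y, diagS_Y]; rfl))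
    (Function.injective_of_subsingleton _) Function.injective_id
    Function.surjective_id (Function.surjective_to_subsingleton _)
    (exact_of_subsingleton_of_injective (0 : diagT.U × diagT.U →+ diagX₁.U × diagX₁.U)
      (β := AddMonoidHom.id (ℝ × ℝ)) Function.injective_id)
    (exact_of_surjective_of_subsingleton Function.surjective_id _)
  rw [h, length_diagS, length_diagT]
  norm_num

/-- Extension `0 → Y₁ → Y₂ → T → 0`, with the first coordinate axis of `V` in the submodule. -/
theorem length_diagY₂ : Module.length A diagY₂.Mod = 3 := by
  have h := Diagram.length_eq_add
    (Diagram.map_apply (D := diagY₁) (D' := diagY₂) (Or.inl diagY₁_X) (Or.inl diagY₂_X)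
      LinearMap.id (LinearMap.inl ℝ ℝ ℝ) (fun _ => rfl)
      (fun w => by rw [diagY₁_X, diagY₂_X]; exact (map_zero (LinearMap.inl ℝ ℝ ℝ)).symm)
      (fun v => rfl))
    (Diagram.map_apply (D := diagY₂) (D' := diagT) (Or.inl diagY₂_X) (Or.inl diagT_X)
      0 (LinearMap.snd ℝ ℝ ℝ) (fun _ => rfl)
      (fun w => by rw [diagY₂_X, diagT_X]; exact (map_zero (LinearMap.snd ℝ ℝ ℝ)).symm)
      (fun _ => rfl))
    Function.injective_id (LinearMap.inl_injective (R := ℝ) (M := ℝ) (M₂ := ℝ))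
    (Function.surjective_to_subsingleton _)
    (LinearMap.snd_surjective (R := ℝ) (M := ℝ) (M₂ := ℝ))
    (exact_of_surjective_of_subsingleton Function.surjective_id _)
    (Function.Exact.inl_snd (R := ℝ) (M := ℝ) (N := ℝ))
  rw [h, length_diagY₁, length_diagT]
  norm_num

/-- Extension `0 → T → X₂ → X₁ → 0`, dividing out the second coordinate axis of `V`. -/
theorem length_diagX₂ : Module.length A diagX₂.Mod = 3 := by
  have h := Diagram.length_eq_add
    (Diagram.map_apply (D := diagT) (D' := diagX₂) (Or.inl diagT_X) (Or.inr diagX₂_Y)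
      0 (LinearMap.inr ℝ ℝ ℝ) (fun _ => map_zero diagX₂.J)
      (fun w => (map_zero diagX₂.X).trans
        (by rw [diagT_X]; exact (map_zero (LinearMap.inr ℝ ℝ ℝ)).symm))
      (fun v => by rw [diagX₂_Y]; rfl))
    (Diagram.map_apply (D := diagX₂) (D' := diagX₁) (Or.inr diagX₂_Y) (Or.inr diagX₁_Y)
      LinearMap.id (LinearMap.fst ℝ ℝ ℝ) (fun _ => rfl)
      (fun w => rfl)
      (fun v => by rw [diagX₂_Y, diagX₁_Y]; rfl))
    (Function.injective_of_subsingleton _) (LinearMap.inr_injective (R := ℝ) (M := ℝ) (M₂ := ℝ))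
    Function.surjective_id (LinearMap.fst_surjective (R := ℝ) (M := ℝ) (M₂ := ℝ))
    (exact_of_subsingleton_of_injective (0 : diagT.U × diagT.U →+ diagX₂.U × diagX₂.U)
      (β := AddMonoidHom.id (ℝ × ℝ)) Function.injective_id)
    (Function.Exact.inr_fst (R := ℝ) (M := ℝ) (N := ℝ))
  rw [h, length_diagX₁, length_diagT]
  norm_num

/-! ### Endomorphism algebras -/

theorem nonempty_algEquiv_real {B : Type*} [Ring B] [Algebra ℝ B] [Nontrivial B]
    (h : ∀ g : B, ∃ a : ℝ, g = a • 1) : Nonempty (B ≃ₐ[ℝ] ℝ) := by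
  refine ⟨(AlgEquiv.ofBijective (Algebra.ofId ℝ B) ⟨RingHom.injective _, fun g => ?_⟩).symm⟩
  obtain ⟨a, rfl⟩ := h g
  exact ⟨a, Algebra.algebraMap_eq_smul_one a⟩

theorem nonempty_algEquiv_complex {B : Type*} [Ring B] [Algebra ℝ B] [Nontrivial B] {i : B}
    (hi : i * i = -1) (h : ∀ g : B, ∃ a b : ℝ, g = a • 1 + b • i) : Nonempty (B ≃ₐ[ℝ] ℂ) := by
  refine ⟨(AlgEquiv.ofBijective (Complex.liftAux i hi) ⟨RingHom.injective _, fun g => ?_⟩).symm⟩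
  obtain ⟨a, b, rfl⟩ := h g
  exact ⟨⟨a, b⟩, by rw [Complex.liftAux_apply, Algebra.algebraMap_eq_smul_one]⟩

theorem isSchurian_of_algEquiv {M K : Type*} [AddCommGroup M] [Module ℝ M] [Module A M]
    [IsScalarTower ℝ A M] [Field K] [Algebra ℝ K] (φ : Module.End A M ≃ₐ[ℝ] K) :
    IsSchurian M := by
  refine ⟨φ.symm.injective.nontrivial, fun g hg => ?_⟩
  have h : IsUnit (φ g) := isUnit_iff_ne_zero.mpr fun h0 => hg (φ.injective (by rw [h0, map_zero]))
  simpa using h.map φ.symm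

theorem isSchurian_of_isSimpleModule {M : Type*} [AddCommGroup M] [Module A M]
    [IsSimpleModule A M] : IsSchurian M := by
  have := IsSimpleModule.nontrivial A M
  exact ⟨inferInstance, fun g hg => (Module.End.isUnit_iff g).mpr
    (LinearMap.bijective_of_ne_zero hg)⟩

/-! ### Homomorphisms determined by one vector -/

section Ext

variable {N : Type*} [AddCommGroup N] [Module ℝ N] [Module A N] [IsScalarTower ℝ A N]

theorem hom_diagY₁_ext {g h : diagY₁.Mod →ₗ[A] N}
    (hv : g (diagY₁.pair 0 (1 : ℝ)) = h (diagY₁.pair 0 (1 : ℝ))) : g = h := by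
  have e1 : genY • diagY₁.pair 0 (1 : ℝ) = diagY₁.pair ((1 : ℝ), (0 : ℝ)) 0 :=
    Diagram.genY_smul _ _
  have e2 : genJ • diagY₁.pair ((1 : ℝ), (0 : ℝ)) 0 = diagY₁.pair ((0 : ℝ), (1 : ℝ)) 0 :=
    (Diagram.genJ_smul _ _).trans
      (congrArg (fun a : ℝ => diagY₁.pair (a, (1 : ℝ)) 0) (neg_zero (G := ℝ)))
  have h1 : g (diagY₁.pair ((1 : ℝ), (0 : ℝ)) 0) = h (diagY₁.pair ((1 : ℝ), (0 : ℝ)) 0) := by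
    rw [← e1, map_smul, map_smul, hv]
  have h2 : g (diagY₁.pair ((0 : ℝ), (1 : ℝ)) 0) = h (diagY₁.pair ((0 : ℝ), (1 : ℝ)) 0) := by
    rw [← e2, map_smul, map_smul, h1]
  -- With the carrier unfolded, `ext` reduces equality to the standard basis.
  let g' : (ℝ × ℝ) × ℝ →ₗ[ℝ] N := g.restrictScalars ℝ
  let h' : (ℝ × ℝ) × ℝ →ₗ[ℝ] N := h.restrictScalars ℝ
  have hgh : g' = h' := by
    ext
    exacts [h1, h2, hv]
  exact LinearMap.ext fun m => LinearMap.congr_fun hgh m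

theorem hom_diagX₁_ext {g h : diagX₁.Mod →ₗ[A] N}
    (hw : g (diagX₁.pair ((1 : ℝ), (0 : ℝ)) 0) = h (diagX₁.pair ((1 : ℝ), (0 : ℝ)) 0)) :
    g = h := by
  have e1 : genX • diagX₁.pair ((1 : ℝ), (0 : ℝ)) 0 = diagX₁.pair 0 (1 : ℝ) :=
    (Diagram.genX_smul _ _).trans (congrArg (diagX₁.pair 0) (diagX₁_X (1, 0)))
  have e2 : genJ • diagX₁.pair ((1 : ℝ), (0 : ℝ)) 0 = diagX₁.pair ((0 : ℝ), (1 : ℝ)) 0 :=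
    (Diagram.genJ_smul _ _).trans
      (congrArg (fun a : ℝ => diagX₁.pair (a, (1 : ℝ)) 0) (neg_zero (G := ℝ)))
  have h1 : g (diagX₁.pair 0 (1 : ℝ)) = h (diagX₁.pair 0 (1 : ℝ)) := by
    rw [← e1, map_smul, map_smul, hw]
  have h2 : g (diagX₁.pair ((0 : ℝ), (1 : ℝ)) 0) = h (diagX₁.pair ((0 : ℝ), (1 : ℝ)) 0) := by
    rw [← e2, map_smul, map_smul, hw]
  let g' : (ℝ × ℝ) × ℝ →ₗ[ℝ] N := g.restrictScalars ℝ
  let h' : (ℝ × ℝ) × ℝ →ₗ[ℝ] N := h.restrictScalars ℝ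
  have hgh : g' = h' := by
    ext
    exacts [hw, h2, h1]
  exact LinearMap.ext fun m => LinearMap.congr_fun hgh m

theorem hom_diagX₂_ext {g h : diagX₂.Mod →ₗ[A] N}
    (hw : g (diagX₂.pair ((1 : ℝ), (0 : ℝ)) 0) = h (diagX₂.pair ((1 : ℝ), (0 : ℝ)) 0)) :
    g = h := by
  have e1 : ∀ p : ℝ × ℝ, genX • diagX₂.pair p 0 = diagX₂.pair 0 p := fun p =>
    (Diagram.genX_smul _ _).trans (congrArg (diagX₂.pair 0) (diagX₂_X p))
  have e2 : genJ • diagX₂.pair ((1 : ℝ), (0 : ℝ)) 0 = diagX₂.pair ((0 : ℝ), (1 : ℝ)) 0 :=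
    (Diagram.genJ_smul _ _).trans
      (congrArg (fun a : ℝ => diagX₂.pair (a, (1 : ℝ)) 0) (neg_zero (G := ℝ)))
  have h2 : g (diagX₂.pair ((0 : ℝ), (1 : ℝ)) 0) = h (diagX₂.pair ((0 : ℝ), (1 : ℝ)) 0) := by
    rw [← e2, map_smul, map_smul, hw]
  have h3 : g (diagX₂.pair 0 ((1 : ℝ), (0 : ℝ))) = h (diagX₂.pair 0 ((1 : ℝ), (0 : ℝ))) := by
    rw [← e1, map_smul, map_smul]
    exact congrArg (fun n => genX • n) hw
  have h4 : g (diagX₂.pair 0 ((0 : ℝ), (1 : ℝ))) = h (diagX₂.pair 0 ((0 : ℝ), (1 : ℝ))) := by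
    rw [← e1, map_smul, map_smul]
    exact congrArg (fun n => genX • n) h2
  let g' : (ℝ × ℝ) × (ℝ × ℝ) →ₗ[ℝ] N := g.restrictScalars ℝ
  let h' : (ℝ × ℝ) × (ℝ × ℝ) →ₗ[ℝ] N := h.restrictScalars ℝ
  have hgh : g' = h' := by
    ext
    exacts [hw, h2, h3, h4]
  exact LinearMap.ext fun m => LinearMap.congr_fun hgh m

end Ext

/-- An endomorphism preserves `U ⊕ U`. -/
theorem Diagram.projV_end_pair {D : Diagram} (g : D.Mod →ₗ[A] D.Mod) (w : D.U × D.U) :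
    D.projV (g (D.pair w 0)) = 0 := by
  have h : idemE • g (D.pair w 0) = g (D.pair w 0) := by
    rw [← map_smul, idemE_smul, projW_pair]
  rw [← h, idemE_smul, projV_pair]

/-- An endomorphism preserves `V`. -/
theorem Diagram.projW_end_pair {D : Diagram} (g : D.Mod →ₗ[A] D.Mod) (v : D.V) :
    D.projW (g (D.pair 0 v)) = 0 := by
  have h : idemE • g (D.pair 0 v) = 0 := by
    rw [← map_smul, idemE_smul, projW_pair]
    exact map_zero g
  rw [idemE_smul] at h
  exact congrArg D.projW h

/-- The vector `(1, 0)` of `U ⊕ U` does not generate this module. An endomorphism is still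
determined on `V`, since it preserves `V` and `y₁` is injective there; this is why only
endomorphisms are treated. -/
theorem end_diagY₂_ext {g h : diagY₂.Mod →ₗ[A] diagY₂.Mod}
    (hw : g (diagY₂.pair ((1 : ℝ), (0 : ℝ)) 0) = h (diagY₂.pair ((1 : ℝ), (0 : ℝ)) 0)) :
    g = h := by
  have e1 : ∀ m : diagY₂.Mod, genY • m = diagY₂.pair (diagY₂.projV m) 0 := fun m =>
    Diagram.genY_smul _ _
  have e2 : genJ • diagY₂.pair ((1 : ℝ), (0 : ℝ)) 0 = diagY₂.pair ((0 : ℝ), (1 : ℝ)) 0 :=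
    (Diagram.genJ_smul _ _).trans
      (congrArg (fun a : ℝ => diagY₂.pair (a, (1 : ℝ)) 0) (neg_zero (G := ℝ)))
  have h2 : g (diagY₂.pair ((0 : ℝ), (1 : ℝ)) 0) = h (diagY₂.pair ((0 : ℝ), (1 : ℝ)) 0) := by
    rw [← e2, map_smul, map_smul, hw]
  have key : ∀ p : ℝ × ℝ, g (diagY₂.pair p 0) = h (diagY₂.pair p 0) →
      g (diagY₂.pair 0 p) = h (diagY₂.pair 0 p) := by
    intro p hp
    have hV : genY • g (diagY₂.pair 0 p) = genY • h (diagY₂.pair 0 p) := by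
      rw [← map_smul, ← map_smul, e1]
      exact hp
    rw [e1, e1] at hV
    exact Diagram.mod_ext
      ((Diagram.projW_end_pair g p).trans (Diagram.projW_end_pair h p).symm)
      (congrArg diagY₂.projW hV)
  let g' : (ℝ × ℝ) × (ℝ × ℝ) →ₗ[ℝ] diagY₂.Mod := g.restrictScalars ℝ
  let h' : (ℝ × ℝ) × (ℝ × ℝ) →ₗ[ℝ] diagY₂.Mod := h.restrictScalars ℝ
  have hgh : g' = h' := by
    apply LinearMap.prod_ext
    · ext1
      · exact LinearMap.ext_ring hw
      · exact LinearMap.ext_ring h2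
    · ext1
      · exact LinearMap.ext_ring (key (1, 0) hw)
      · exact LinearMap.ext_ring (key (0, 1) h2)
  exact LinearMap.ext fun m => LinearMap.congr_fun hgh m

/-- The generator spans `V = ℝ`, which is preserved, so it is sent to a real multiple of itself. -/
theorem end_diagY₁ : Nonempty (Module.End A diagY₁.Mod ≃ₐ[ℝ] ℝ) := by
  have : Nontrivial diagY₁.Mod := inferInstanceAs (Nontrivial ((ℝ × ℝ) × ℝ))
  refine nonempty_algEquiv_real fun g => ?_
  obtain ⟨a, ha⟩ : ∃ a : ℝ, a = diagY₁.projV (g (diagY₁.pair 0 (1 : ℝ))) := ⟨_, rfl⟩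
  refine ⟨a, hom_diagY₁_ext (Diagram.mod_ext ?_ ?_)⟩
  · exact (Diagram.projW_end_pair g _).trans (smul_zero a).symm
  · exact ha.symm.trans (mul_one a).symm

theorem end_diagX₁ : Nonempty (Module.End A diagX₁.Mod ≃ₐ[ℝ] ℝ) := by
  have : Nontrivial diagX₁.Mod := inferInstanceAs (Nontrivial ((ℝ × ℝ) × ℝ))
  refine nonempty_algEquiv_real fun g => ?_
  obtain ⟨p, hp⟩ : ∃ p : ℝ × ℝ, p = diagX₁.projW (g (diagX₁.pair ((1 : ℝ), (0 : ℝ)) 0)) :=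
    ⟨_, rfl⟩
  -- The generator is killed by `x₁ȷ`; so is its image `p`, which forces the imaginary part of `p`
  -- to vanish.
  have e1 : genX • genJ • diagX₁.pair ((1 : ℝ), (0 : ℝ)) 0 = 0 := by
    rw [Diagram.genJ_smul, Diagram.genX_smul]
    refine (congrArg (diagX₁.pair 0) (diagX₁_X (-0, 1))).trans ?_
    exact congrArg (fun a : ℝ => diagX₁.pair 0 a) neg_zero
  have e2 : genX • genJ • g (diagX₁.pair ((1 : ℝ), (0 : ℝ)) 0) = 0 := by
    rw [← map_smul, ← map_smul, e1, map_zero]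
  rw [Diagram.genJ_smul, Diagram.genX_smul, Diagram.projW_pair, ← hp] at e2
  have hp2 : -p.2 = 0 := (diagX₁_X (-p.2, p.1)).symm.trans (congrArg diagX₁.projV e2)
  refine ⟨p.1, hom_diagX₁_ext (Diagram.mod_ext ?_ ?_)⟩
  · refine hp.symm.trans (Prod.ext_iff.mpr ⟨(mul_one p.1).symm, ?_⟩)
    exact (neg_eq_zero.mp hp2).trans (mul_zero p.1).symm
  · exact (Diagram.projV_end_pair g _).trans (smul_zero p.1).symm

/-- The rotation by a right angle. -/
def rotation : ℝ × ℝ →ₗ[ℝ] ℝ × ℝ := (-LinearMap.snd ℝ ℝ ℝ).prod (LinearMap.fst ℝ ℝ ℝ)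

theorem rotation_apply (p : ℝ × ℝ) : rotation p = (-p.2, p.1) := rfl

/-- The complex structure on `diagY₂.Mod`. -/
def rotY₂ : Module.End A diagY₂.Mod :=
  Diagram.map (D := diagY₂) (D' := diagY₂) (Or.inl diagY₂_X) (Or.inl diagY₂_X)
    rotation rotation (fun _ => rfl)
    (fun w => by rw [diagY₂_X]; exact (map_zero rotation).symm) (fun _ => rfl)

/-- The complex structure on `diagX₂.Mod`. -/
def rotX₂ : Module.End A diagX₂.Mod :=
  Diagram.map (D := diagX₂) (D' := diagX₂) (Or.inr diagX₂_Y) (Or.inr diagX₂_Y)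
    rotation rotation (fun _ => rfl)
    (fun w => (diagX₂_X (rotation w)).trans (congrArg rotation (diagX₂_X w)).symm)
    (fun v => by rw [diagX₂_Y]; exact (map_zero rotation).symm)

theorem end_diagY₂ : Nonempty (Module.End A diagY₂.Mod ≃ₐ[ℝ] ℂ) := by
  have : Nontrivial diagY₂.Mod := inferInstanceAs (Nontrivial ((ℝ × ℝ) × (ℝ × ℝ)))
  refine nonempty_algEquiv_complex (i := rotY₂) ?_ fun g => ?_
  · refine end_diagY₂_ext (Diagram.mod_ext rfl ?_)
    exact congrArg rotation (map_zero rotation) |>.trans ((map_zero rotation).trans neg_zero.symm)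
  · obtain ⟨p, hp⟩ : ∃ p : ℝ × ℝ, p = diagY₂.projW (g (diagY₂.pair ((1 : ℝ), (0 : ℝ)) 0)) :=
      ⟨_, rfl⟩
    refine ⟨p.1, p.2, end_diagY₂_ext (Diagram.mod_ext (hp.symm.trans ?_)
      ((Diagram.projV_end_pair g _).trans (Diagram.projV_end_pair _ _).symm))⟩
    have key : p = p.1 • ((1 : ℝ), (0 : ℝ)) + p.2 • rotation (1, 0) := by
      simp [rotation_apply]
    exact key

theorem end_diagX₂ : Nonempty (Module.End A diagX₂.Mod ≃ₐ[ℝ] ℂ) := by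
  have : Nontrivial diagX₂.Mod := inferInstanceAs (Nontrivial ((ℝ × ℝ) × (ℝ × ℝ)))
  refine nonempty_algEquiv_complex (i := rotX₂) ?_ fun g => ?_
  · refine hom_diagX₂_ext (Diagram.mod_ext rfl ?_)
    exact congrArg rotation (map_zero rotation) |>.trans ((map_zero rotation).trans neg_zero.symm)
  · obtain ⟨p, hp⟩ : ∃ p : ℝ × ℝ, p = diagX₂.projW (g (diagX₂.pair ((1 : ℝ), (0 : ℝ)) 0)) :=
      ⟨_, rfl⟩
    refine ⟨p.1, p.2, hom_diagX₂_ext (Diagram.mod_ext (hp.symm.trans ?_)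
      ((Diagram.projV_end_pair g _).trans (Diagram.projV_end_pair _ _).symm))⟩
    have key : p = p.1 • ((1 : ℝ), (0 : ℝ)) + p.2 • rotation (1, 0) := by
      simp [rotation_apply]
    exact key

/-! ### The six modules are Schurian and pairwise non-isomorphic -/

theorem isSchurian_sixDiagrams (i : Fin 6) : IsSchurian (sixDiagrams i).Mod := by
  have := isSimpleModule_diagS
  have := isSimpleModule_diagT
  have hS : IsSchurian diagS.Mod := isSchurian_of_isSimpleModule
  have hT : IsSchurian diagT.Mod := isSchurian_of_isSimpleModule
  have hY₁ : IsSchurian diagY₁.Mod := end_diagY₁.elim isSchurian_of_algEquiv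
  have hX₁ : IsSchurian diagX₁.Mod := end_diagX₁.elim isSchurian_of_algEquiv
  have hY₂ : IsSchurian diagY₂.Mod := end_diagY₂.elim isSchurian_of_algEquiv
  have hX₂ : IsSchurian diagX₂.Mod := end_diagX₂.elim isSchurian_of_algEquiv
  fin_cases i
  exacts [hS, hT, hY₁, hX₁, hY₂, hX₂]

theorem finrank_sixDiagrams (i : Fin 6) :
    Module.finrank ℝ (sixDiagrams i).Mod = ![2, 1, 3, 3, 4, 4] i := by
  have h3 : Module.finrank ℝ ((ℝ × ℝ) × ℝ) = 3 := by simp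
  have h4 : Module.finrank ℝ ((ℝ × ℝ) × (ℝ × ℝ)) = 4 := by simp
  fin_cases i
  exacts [finrank_diagS, finrank_diagT, h3, h3, h4, h4]

/-- This invariant separates the two pairs of equal real dimension. -/
theorem genY_smul_eq_zero_iff (i : Fin 6) :
    (∀ m : (sixDiagrams i).Mod, genY • m = 0) ↔ ![true, true, false, true, false, true] i := by
  have h0 : ∀ D : Diagram, D.Y = 0 → ∀ m : D.Mod, genY • m = 0 := fun D hD m => by
    rw [Diagram.genY_smul, hD]
    rfl
  have h1 : ¬ ∀ m : diagY₁.Mod, genY • m = 0 := fun h => one_ne_zero (α := ℝ)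
    (congrArg (fun m : diagY₁.Mod => (diagY₁.projW m).1)
      ((Diagram.genY_smul _ _).symm.trans (h (diagY₁.pair 0 (1 : ℝ)))))
  have h2 : ¬ ∀ m : diagY₂.Mod, genY • m = 0 := fun h => one_ne_zero (α := ℝ)
    (congrArg (fun m : diagY₂.Mod => (diagY₂.projW m).1)
      ((Diagram.genY_smul _ _).symm.trans (h (diagY₂.pair 0 ((1 : ℝ), (0 : ℝ))))))
  fin_cases i
  exacts [iff_of_true (h0 _ diagS_Y) rfl, iff_of_true (h0 _ diagT_Y) rfl,
    iff_of_false h1 Bool.false_ne_true, iff_of_true (h0 _ diagX₁_Y) rfl,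
    iff_of_false h2 Bool.false_ne_true, iff_of_true (h0 _ diagX₂_Y) rfl]

theorem eq_of_equiv {i j : Fin 6} (φ : (sixDiagrams i).Mod ≃ₗ[A] (sixDiagrams j).Mod) :
    i = j := by
  have hd := (φ.restrictScalars ℝ).finrank_eq
  rw [finrank_sixDiagrams, finrank_sixDiagrams] at hd
  have hy : (∀ m : (sixDiagrams i).Mod, genY • m = 0) ↔
      ∀ m : (sixDiagrams j).Mod, genY • m = 0 := by
    constructor
    · intro h m
      rw [← φ.apply_symm_apply m, ← map_smul, h, map_zero]
    · intro h m
      rw [← φ.symm_apply_apply m, ← map_smul, h, map_zero]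
  rw [genY_smul_eq_zero_iff, genY_smul_eq_zero_iff] at hy
  -- What remains is a comparison of two finite tables of invariants over `Fin 6`.
  clear φ
  revert i j
  decide

end RealGelfand

end

theorem theoremT :
    -- the six modules: two simple ones, two of length two, two of length three
    (IsSimpleModule RealGelfand.A RealGelfand.diagS.Mod ∧
      RealGelfand.HasDimVector RealGelfand.diagS.Mod 1 0) ∧
    (IsSimpleModule RealGelfand.A RealGelfand.diagT.Mod ∧
      RealGelfand.HasDimVector RealGelfand.diagT.Mod 0 1) ∧
    (Module.length RealGelfand.A RealGelfand.diagY₁.Mod = 2 ∧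
      Nonempty (Module.End RealGelfand.A RealGelfand.diagY₁.Mod ≃ₐ[ℝ] ℝ)) ∧
    (Module.length RealGelfand.A RealGelfand.diagX₁.Mod = 2 ∧
      Nonempty (Module.End RealGelfand.A RealGelfand.diagX₁.Mod ≃ₐ[ℝ] ℝ)) ∧
    (Module.length RealGelfand.A RealGelfand.diagY₂.Mod = 3 ∧
      Nonempty (Module.End RealGelfand.A RealGelfand.diagY₂.Mod ≃ₐ[ℝ] ℂ)) ∧
    (Module.length RealGelfand.A RealGelfand.diagX₂.Mod = 3 ∧
      Nonempty (Module.End RealGelfand.A RealGelfand.diagX₂.Mod ≃ₐ[ℝ] ℂ)) ∧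
    -- they are Schurian and pairwise non-isomorphic
    (∀ i, RealGelfand.IsSchurian (RealGelfand.sixDiagrams i).Mod) ∧
    (∀ i j, Nonempty ((RealGelfand.sixDiagrams i).Mod ≃ₗ[RealGelfand.A]
      (RealGelfand.sixDiagrams j).Mod) → i = j) ∧
    -- every finite dimensional Schurian module is isomorphic to one of them
    (∀ (M : Type*) [AddCommGroup M] [Module ℝ M] [Module RealGelfand.A M]
      [IsScalarTower ℝ RealGelfand.A M] [FiniteDimensional ℝ M], RealGelfand.IsSchurian M →
        ∃ i, Nonempty (M ≃ₗ[RealGelfand.A] (RealGelfand.sixDiagrams i).Mod)) := by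
  open RealGelfand in
  exact ⟨⟨isSimpleModule_diagS, hasDimVector_diagS⟩, ⟨isSimpleModule_diagT, hasDimVector_diagT⟩,
    ⟨length_diagY₁, end_diagY₁⟩, ⟨length_diagX₁, end_diagX₁⟩, ⟨length_diagY₂, end_diagY₂⟩,
    ⟨length_diagX₂, end_diagX₂⟩, isSchurian_sixDiagrams, fun _ _ ⟨φ⟩ => eq_of_equiv φ,
    fun _ _ _ _ _ _ h => h.exists_equiv⟩
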